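/- Consider two-stage Markov decision processes with uncertain terminal rewards. An instance consists of an initial state $s_0$, finite sets of states $S_1$ and $S_2$ (the states in $S_2$ being terminal), nonempty finite action sets $A(s_0)$ and $A(s)$ for $s \in S_1$, probability distributions $p(\cdot\mid s_0,a)$ on $S_1$ for $a \in A(s_0)$ and $p(\cdot\mid s,a)$ on $S_2$ for $s \in S_1$, $a \in A(s)$, and for each $t \in S_2$ a nominal reward $r(t)$ and an alternative reward $r'(t)$ with $0 \le r'(t) \le r(t)$. All probabilities and rewards are rational and encoded in binary. A policy $\pi$ chooses one action $\pi(s) \in A(s)$ for every $s \in \{s_0\} \cup S_1$. Under $\pi$ the process ends in $t \in S_2$ with probability $P_\pi(t) = \sum_{s \in S_1} p(s\mid s_0,\pi(s_0))\, p(t\mid s,\pi(s))$. Let $$R(\pi) = \sum_{t \in S_2} P_\pi(t)\, r(t), \qquad \hat R(\pi) = \min_{\hat r \in \hat{\mathcal Q}} \sum_{t \in S_2} P_\pi(t)\, \hat r(t), \qquad L(\pi) = R(\pi) - \hat R(\pi),$$ where $\hat{\mathcal Q}$ is the set of all $\hat r \colon S_2 \to \mathbb{Q}$ with $\hat r(t)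 \in \{r(t), r'(t)\}$ for all $t$ and $\hat r(t) \ne r(t)$ for at most one $t$. **Theorem.** For every real $\varepsilon > 0$ there is a deterministic algorithm that, given any such instance, computes in time polynomial in the encoding length of the instance (in the logarithmic-cost random access machine model) a policy $\pi_1$ such that $$\hat R(\pi_1) \ \ge\ \frac{1}{1+\varepsilon}\, \min\{\hat R(\pi),\, L(\pi)\} \qquad \text{for all policies } \pi .$$ -/

import Mathlib

/-! ### Machine model: random access machine with logarithmic cost

Programs are structured (`skip`, assignment, sequence, `if`, `while`).  The memory consists of arrays
`0, 1, 2, …` of natural-number registers of unbounded length; a program mentions finitely many array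
names, and registers inside an array are addressed indirectly.  The elementary operations are `+`,
truncated `-`, `*` and integer `/`.  Every evaluation of an operand is charged one plus the number of
bits of its value, addresses included. -/

namespace RAM

/-- Memory: the content of register `i` of array `a` is `σ a i`. -/
abbrev Memory : Type := ℕ → ℕ → ℕ

/-- Expressions; `get a e` reads the register of array `a` whose address is the value of `e`. -/
inductive Expr : Type
  | lit (n : ℕ)
  | get (a : ℕ) (e : Expr)
  | add (e₁ e₂ : Expr)
  | sub (e₁ e₂ : Expr)
  | mul (e₁ e₂ : Expr)
  | div (e₁ e₂ : Expr)

namespace Expr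

/-- The value of an expression. -/
def eval (σ : Memory) : Expr → ℕ
  | lit n => n
  | get a e => σ a (e.eval σ)
  | add e₁ e₂ => e₁.eval σ + e₂.eval σ
  | sub e₁ e₂ => e₁.eval σ - e₂.eval σ
  | mul e₁ e₂ => e₁.eval σ * e₂.eval σ
  | div e₁ e₂ => e₁.eval σ / e₂.eval σ

/-- The logarithmic cost of evaluating an expression: every node is charged one plus the bit length
of its value, in addition to the cost of its operands. -/
def cost (σ : Memory) : Expr → ℕ
  | lit n => 1 + Nat.size n
  | get a e => e.cost σ + (1 + Nat.size ((get a e).eval σ))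
  | add e₁ e₂ => e₁.cost σ + e₂.cost σ + (1 + Nat.size ((add e₁ e₂).eval σ))
  | sub e₁ e₂ => e₁.cost σ + e₂.cost σ + (1 + Nat.size ((sub e₁ e₂).eval σ))
  | mul e₁ e₂ => e₁.cost σ + e₂.cost σ + (1 + Nat.size ((mul e₁ e₂).eval σ))
  | div e₁ e₂ => e₁.cost σ + e₂.cost σ + (1 + Nat.size ((div e₁ e₂).eval σ))

end Expr

/-- Programs.  `set a i e` stores the value of `e` in the register of array `a` whose address is the
value of `i`.  A test succeeds when the value of the expression is nonzero. -/
inductive Prog : Type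
  | skip
  | set (a : ℕ) (i e : Expr)
  | seq (P Q : Prog)
  | ite (e : Expr) (P Q : Prog)
  | loop (e : Expr) (P : Prog)

/-- Overwriting one register. -/
def write (σ : Memory) (a i v : ℕ) : Memory :=
  fun a' i' => if a' = a ∧ i' = i then v else σ a' i'

/-- `Exec P σ c σ'`: started in memory `σ`, the program `P` halts in memory `σ'` at total cost `c`. -/
inductive Exec : Prog → Memory → ℕ → Memory → Prop
  | skip (σ : Memory) : Exec .skip σ 1 σ
  | set (a : ℕ) (i e : Expr) (σ : Memory) :
      Exec (.set a i e) σ (i.cost σ + e.cost σ + 1) (write σ a (i.eval σ) (e.eval σ))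
  | seq {P Q : Prog} {σ₁ σ₂ σ₃ : Memory} {c d : ℕ} :
      Exec P σ₁ c σ₂ → Exec Q σ₂ d σ₃ → Exec (.seq P Q) σ₁ (c + d) σ₃
  | iteTrue {e : Expr} {P Q : Prog} {σ₁ σ₂ : Memory} {c : ℕ} :
      e.eval σ₁ ≠ 0 → Exec P σ₁ c σ₂ → Exec (.ite e P Q) σ₁ (e.cost σ₁ + c) σ₂
  | iteFalse {e : Expr} {P Q : Prog} {σ₁ σ₂ : Memory} {c : ℕ} :
      e.eval σ₁ = 0 → Exec Q σ₁ c σ₂ → Exec (.ite e P Q) σ₁ (e.cost σ₁ + c) σ₂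
  | loopTrue {e : Expr} {P : Prog} {σ₁ σ₂ σ₃ : Memory} {c d : ℕ} :
      e.eval σ₁ ≠ 0 → Exec P σ₁ c σ₂ → Exec (.loop e P) σ₂ d σ₃ →
        Exec (.loop e P) σ₁ (e.cost σ₁ + c + d) σ₃
  | loopFalse {e : Expr} {P : Prog} {σ : Memory} :
      e.eval σ = 0 → Exec (.loop e P) σ (e.cost σ) σ

/-- Executions are deterministic, so a program has at most one output and one running time. -/
theorem Exec.deterministic {P : Prog} {σ τ τ' : Memory} {c c' : ℕ}
    (h : Exec P σ c τ) (h' : Exec P σ c' τ') : c = c' ∧ τ = τ' := by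
  induction h generalizing c' τ' with
  | skip σ => cases h'; exact ⟨rfl, rfl⟩
  | set a i e σ => cases h'; exact ⟨rfl, rfl⟩
  | seq _ _ ih₁ ih₂ =>
    cases h' with
    | seq k₁ k₂ =>
      obtain ⟨rfl, rfl⟩ := ih₁ k₁
      obtain ⟨rfl, rfl⟩ := ih₂ k₂
      exact ⟨rfl, rfl⟩
  | iteTrue he _ ih =>
    cases h' with
    | iteTrue _ k => obtain ⟨rfl, rfl⟩ := ih k; exact ⟨rfl, rfl⟩
    | iteFalse he' _ => exact absurd he' he
  | iteFalse he _ ih =>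
    cases h' with
    | iteTrue he' _ => exact absurd he he'
    | iteFalse _ k => obtain ⟨rfl, rfl⟩ := ih k; exact ⟨rfl, rfl⟩
  | loopTrue he _ _ ih₁ ih₂ =>
    cases h' with
    | loopTrue _ k₁ k₂ =>
      obtain ⟨rfl, rfl⟩ := ih₁ k₁
      obtain ⟨rfl, rfl⟩ := ih₂ k₂
      exact ⟨rfl, rfl⟩
    | loopFalse he' => exact absurd he' he
  | loopFalse he =>
    cases h' with
    | loopTrue he' _ _ => exact absurd he he'
    | loopFalse _ => exact ⟨rfl, rfl⟩

/-- The initial memory for the input `x`: array `0` holds the length of `x` in register `0` and the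
entries of `x` in the registers `1, 2, …`; every other register is `0`. -/
def initMemory (x : List ℕ) : Memory :=
  fun a i => if a = 0 then (x.length :: x).getD i 0 else 0

/-- The memory `σ` presents the output `y`: array `1` holds the length of `y` in register `0` and the
entries of `y` in the registers `1, …, y.length`. -/
def HasOutput (σ : Memory) (y : List ℕ) : Prop :=
  σ 1 0 = y.length ∧ ∀ i : Fin y.length, σ 1 (i + 1) = y.get i

/-- On input `x`, the program `P` halts with output `y` at logarithmic cost at most `b`. -/
def Prog.OutputsWithin (P : Prog) (x y : List ℕ) (b : ℕ) : Prop :=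
  ∃ (c : ℕ) (σ : Memory), Exec P (initMemory x) c σ ∧ HasOutput σ y ∧ c ≤ b

/-- The encoding length of a list of natural numbers written in binary, with a separator after each
entry. -/
def inputSize (x : List ℕ) : ℕ := (x.map fun n => Nat.size n + 1).sum

end RAM

/-! ### Two-stage Markov decision processes with uncertain terminal rewards -/

/-- An instance of 2-Stage Reward-DLP with rational data.  The state space is the disjoint union of
`S₀ = {s₀}`, `S₁ = Fin n₁` and the set `S₂ = Fin n₂` of terminal states.  The actions are
`A(s₀) = Fin m₀` and `A(s) = Fin (m s)` for `s ∈ S₁`; only terminal states have no action.  The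
transition kernel leads from `s₀` to `S₁` and from `S₁` to `S₂`.  A terminal state `t` has the nominal
reward `r t` and the alternative reward `r' t`. -/
structure TwoStageRewardDLP : Type where
  n₁ : ℕ
  n₂ : ℕ
  m₀ : ℕ
  m : Fin n₁ → ℕ
  m₀_pos : 0 < m₀
  m_pos : ∀ s, 0 < m s
  /-- `p₀ a s` is the probability `p(s | s₀, a)`. -/
  p₀ : Fin m₀ → Fin n₁ → ℚ
  p₀_nonneg : ∀ a s, 0 ≤ p₀ a s
  p₀_sum : ∀ a, ∑ s, p₀ a s = 1
  /-- `p₁ s a t` is the probability `p(t | s, a)`. -/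
  p₁ : (s : Fin n₁) → Fin (m s) → Fin n₂ → ℚ
  p₁_nonneg : ∀ s a t, 0 ≤ p₁ s a t
  p₁_sum : ∀ s a, ∑ t, p₁ s a t = 1
  r : Fin n₂ → ℚ
  r' : Fin n₂ → ℚ
  r'_nonneg : ∀ t, 0 ≤ r' t
  r'_le_r : ∀ t, r' t ≤ r t

namespace TwoStageRewardDLP

variable (I : TwoStageRewardDLP)

/-- A deterministic, history-independent policy: an action at each nonterminal state. -/
@[ext]
structure Policy : Type where
  init : Fin I.m₀
  act : (s : Fin I.n₁) → Fin (I.m s)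

variable {I}

/-- The probability that the state sequence induced by the policy ends in the terminal state `t`. -/
def terminalProb (π : I.Policy) (t : Fin I.n₂) : ℚ :=
  ∑ s, I.p₀ π.init s * I.p₁ s (π.act s) t

/-- The expected terminal reward of the policy when the terminal rewards are `q`. -/
def expectedReward (π : I.Policy) (q : Fin I.n₂ → ℚ) : ℚ :=
  ∑ t, terminalProb π t * q t

/-- The nominal reward `R(π)`. -/
def reward (π : I.Policy) : ℚ := expectedReward π I.r

variable (I) in
/-- The budgeted uncertainty set: each terminal reward is nominal or alternative, and at most `k` of
them differ from the nominal ones. -/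
def uncertaintySet (k : ℕ) : Finset (Fin I.n₂ → ℚ) :=
  (Fintype.piFinset fun t => ({I.r t, I.r' t} : Finset ℚ)).filter fun q =>
    (Finset.univ.filter fun t => q t ≠ I.r t).card ≤ k

variable (I) in
theorem uncertaintySet_nonempty (k : ℕ) : (I.uncertaintySet k).Nonempty :=
  ⟨I.r, by simp [uncertaintySet]⟩

/-- The worst-case reward `R̂(π)`, for the uncertainty budget `k = 1`. -/
def worstReward (π : I.Policy) : ℚ :=
  (I.uncertaintySet 1).inf' (I.uncertaintySet_nonempty 1) (expectedReward π)

/-- The loss `L(π) = R(π) - R̂(π)`. -/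
def loss (π : I.Policy) : ℚ := reward π - worstReward π

/-- A nonnegative rational number as numerator and denominator, in lowest terms. -/
def encodeRat (q : ℚ) : List ℕ := [q.num.toNat, q.den]

variable (I) in
/-- The encoding of an instance: the sizes `n₁, n₂, m₀`, the numbers of actions `m s`, the transition
probabilities out of `s₀`, those out of `S₁`, the nominal rewards and the alternative rewards. -/
def encode : List ℕ :=
  [I.n₁, I.n₂, I.m₀] ++ List.ofFn I.m
    ++ ((List.finRange I.m₀).flatMap fun a =>
        (List.finRange I.n₁).flatMap fun s => encodeRat (I.p₀ a s))
    ++ ((List.finRange I.n₁).flatMap fun s => (List.finRange (I.m s)).flatMap fun a =>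
        (List.finRange I.n₂).flatMap fun t => encodeRat (I.p₁ s a t))
    ++ ((List.finRange I.n₂).flatMap fun t => encodeRat (I.r t))
    ++ ((List.finRange I.n₂).flatMap fun t => encodeRat (I.r' t))

/-- The encoding of a policy: the action at `s₀`, followed by the actions at the states of `S₁`. -/
def Policy.encode (π : I.Policy) : List ℕ :=
  (π.init : ℕ) :: List.ofFn fun s => (π.act s : ℕ)

end TwoStageRewardDLP

/-! For a policy `π` and a terminal state `t` put `ℓ_t(π) = P_π(t) (r(t) - r'(t)) ≥ 0`. Then `L(π)`
is the largest `ℓ_t(π)` and `R̂(π) = R(π) - L(π)`, so `min {R̂(π), L(π)}` equals `min {ℓ_t(π), R(π)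
- ℓ_t(π)}` for a worst `t` (`exists_min_le_min_lossAt`). Conversely `min {ℓ_t, R - ℓ_t} ≤ R̂` for
every `t` (`min_lossAt_le_worstReward`): if the adversary deviates at some `u ≠ t`, the reward
collected at `t` survives, and it is at least `ℓ_t`. Hence it suffices to maximize the score `min
{ℓ_t(π), R(π) - ℓ_t(π)}` over `π` and `t` up to the factor `1 + ε`.

Once the initial action and `t` are fixed, `ℓ_t` and `R - ℓ_t` are sums over `s ∈ S₁` of nonnegative
terms, the gain and the rest, that depend only on the action at `s`. This is a multiple-choice
knapsack with two criteria. Guess the largest gain `M` that the comparison policy uses, clip the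
gains at `M` and round them down to multiples of `M / (K n₁)`. At most `K n₁² + 1` rounded sums are
possible, and a dynamic program finds, for each attainable target sum, a policy of maximal rest
whose rounded gain reaches the target (`IsTable.optimal`). Rounding costs at most `M / K`, hence at
most a fraction `1 / K` of the total gain (`sub_one_mul_sum_le_of_rounded`). Trying all initial
actions, terminal states, state-action pairs that define `M`, and targets, and keeping the best true
score, loses only the factor `(K - 1) / K`.

For the running time, all rationals are scaled by the product of their denominators, so that every
register has at most `B` bits and every loop at most `L` iterations, with `B` and `L` polynomial in
the encoding length. `WP` couples correctness with the syntactic cost bound `costWeight L * (B +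
1)`, which is polynomial by `exists_polynomial_costWeight`; `scheme_solves` is the outcome for the
whole program. -/

/-! ### Weakest preconditions with syntactic cost bounds -/

namespace RAM

/-- All registers hold numbers of at most `B` bits. -/
def Bounded (B : ℕ) (σ : Memory) : Prop := ∀ a i, σ a i < 2 ^ B

namespace Expr

/-- The size of the value of an expression, in multiples of the size of the registers. -/
def valueWeight : Expr → ℕ
  | lit n => Nat.size n
  | get _ _ => 1
  | add e₁ e₂ => e₁.valueWeight + e₂.valueWeight + 1
  | sub e₁ _ => e₁.valueWeight
  | mul e₁ e₂ => e₁.valueWeight + e₂.valueWeight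
  | div e₁ _ => e₁.valueWeight

/-- The cost of an expression, in multiples of the size of the registers. -/
def costWeight : Expr → ℕ
  | lit n => 1 + Nat.size n
  | get _ e => e.costWeight + 1
  | add e₁ e₂ => e₁.costWeight + e₂.costWeight + (1 + (add e₁ e₂).valueWeight)
  | sub e₁ e₂ => e₁.costWeight + e₂.costWeight + (1 + (sub e₁ e₂).valueWeight)
  | mul e₁ e₂ => e₁.costWeight + e₂.costWeight + (1 + (mul e₁ e₂).valueWeight)
  | div e₁ e₂ => e₁.costWeight + e₂.costWeight + (1 + (div e₁ e₂).valueWeight)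

/-- Bit lengths at most add up under each operation, and a sum may carry one more bit, which the
extra `1` in its `valueWeight` covers. Counting in multiples of `B + 1`, which is positive, also
covers literals when `B = 0`. -/
theorem size_eval_le {B : ℕ} {σ : Memory} (h : Bounded B σ) (e : Expr) :
    Nat.size (e.eval σ) ≤ e.valueWeight * (B + 1) := by
  induction e with
  | lit n => exact Nat.le_mul_of_pos_right _ (Nat.succ_pos _)
  | get a e _ =>
    simp only [valueWeight, one_mul]
    exact (Nat.size_le.2 (h _ _)).trans (Nat.le_succ _)
  | add e₁ e₂ ih₁ ih₂ =>
    rw [Nat.size_le] at *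
    simp only [eval, valueWeight]
    have h₁ : 2 ^ (e₁.valueWeight * (B + 1)) ≤
        2 ^ ((e₁.valueWeight + e₂.valueWeight) * (B + 1)) :=
      Nat.pow_le_pow_right (by norm_num) (by nlinarith)
    have h₂ : 2 ^ (e₂.valueWeight * (B + 1)) ≤
        2 ^ ((e₁.valueWeight + e₂.valueWeight) * (B + 1)) :=
      Nat.pow_le_pow_right (by norm_num) (by nlinarith)
    have h₃ : 2 ^ ((e₁.valueWeight + e₂.valueWeight) * (B + 1) + 1) ≤
        2 ^ ((e₁.valueWeight + e₂.valueWeight + 1) * (B + 1)) :=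
      Nat.pow_le_pow_right (by norm_num) (by nlinarith)
    rw [pow_succ] at h₃
    omega
  | sub e₁ e₂ ih₁ _ => exact (Nat.size_le_size (Nat.sub_le _ _)).trans ih₁
  | mul e₁ e₂ ih₁ ih₂ =>
    rw [Nat.size_le] at *
    simp only [eval, valueWeight]
    rw [add_mul, pow_add]
    exact Nat.mul_lt_mul'' ih₁ ih₂
  | div e₁ e₂ ih₁ _ => exact (Nat.size_le_size (Nat.div_le_self _ _)).trans ih₁

theorem cost_le {B : ℕ} {σ : Memory} (h : Bounded B σ) (e : Expr) :
    e.cost σ ≤ e.costWeight * (B + 1) := by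
  induction e with
  | lit n => exact Nat.le_mul_of_pos_right _ (Nat.succ_pos _)
  | get a e ih =>
    have := size_eval_le h (get a e)
    simp only [cost, costWeight, valueWeight] at *
    have := Nat.size_le.2 (h a (e.eval σ))
    simp only [eval]
    nlinarith
  | add e₁ e₂ ih₁ ih₂ | sub e₁ e₂ ih₁ ih₂ | mul e₁ e₂ ih₁ ih₂ | div e₁ e₂ ih₁ ih₂ =>
    simp only [cost, costWeight]
    refine (add_le_add (add_le_add ih₁ ih₂) (add_le_add (Nat.le_add_left 1 B)
      (size_eval_le h _))).trans (le_of_eq ?_)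
    ring

end Expr

namespace Prog

/-- The arrays to which a program may write. -/
def writes : Prog → List ℕ
  | skip => []
  | set a _ _ => [a]
  | seq P Q => P.writes ++ Q.writes
  | ite _ P Q => P.writes ++ Q.writes
  | loop _ P => P.writes

/-- The cost of a program whose loops are iterated at most `L` times, in multiples of the size of the
registers. -/
def costWeight (L : ℕ) : Prog → ℕ
  | skip => 1
  | set _ i e => i.costWeight + e.costWeight + 1
  | seq P Q => P.costWeight L + Q.costWeight L
  | ite e P Q => e.costWeight + (P.costWeight L + Q.costWeight L)
  | loop e P => (L + 1) * (e.costWeight + P.costWeight L)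

/-- Only loops bring in `L`, each as one factor `L + 1`, so the degree is at most the nesting depth.
This is the source of the polynomial time bound. -/
theorem exists_polynomial_costWeight (P : Prog) :
    ∃ p : Polynomial ℕ, ∀ L, P.costWeight L = p.eval L := by
  induction P with
  | skip => exact ⟨1, fun L => by simp [costWeight]⟩
  | set a i e => exact ⟨Polynomial.C (i.costWeight + e.costWeight + 1), fun L => by simp [costWeight]⟩
  | seq P Q ihP ihQ =>
    obtain ⟨p, hp⟩ := ihP
    obtain ⟨q, hq⟩ := ihQ
    exact ⟨p + q, fun L => by simp [costWeight, hp, hq]⟩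
  | ite e P Q ihP ihQ =>
    obtain ⟨p, hp⟩ := ihP
    obtain ⟨q, hq⟩ := ihQ
    exact ⟨Polynomial.C e.costWeight + (p + q), fun L => by simp [costWeight, hp, hq]⟩
  | loop e P ih =>
    obtain ⟨p, hp⟩ := ih
    exact ⟨(Polynomial.X + 1) * (Polynomial.C e.costWeight + p), fun L => by
      simp [costWeight, hp]⟩

end Prog

/-- Subroutines use disjoint work arrays where possible; what a subroutine preserves is then settled
by deciding membership in the list `writes`. -/
theorem Exec.frame {P : Prog} {σ τ : Memory} {c : ℕ} (h : Exec P σ c τ) :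
    ∀ a, a ∉ P.writes → τ a = σ a := by
  induction h with
  | skip σ => exact fun _ _ => rfl
  | set a i e σ =>
    intro a' ha'
    have : a' ≠ a := by simpa [Prog.writes] using ha'
    funext j
    simp [write, this]
  | seq _ _ ih₁ ih₂ =>
    intro a ha
    simp only [Prog.writes, List.mem_append, not_or] at ha
    rw [ih₂ a ha.2, ih₁ a ha.1]
  | iteTrue _ _ ih =>
    intro a ha
    simp only [Prog.writes, List.mem_append, not_or] at ha
    exact ih a ha.1
  | iteFalse _ _ ih =>
    intro a ha
    simp only [Prog.writes, List.mem_append, not_or] at ha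
    exact ih a ha.2
  | loopTrue _ _ _ ih₁ ih₂ =>
    intro a ha
    rw [ih₂ a ha, ih₁ a ha]
  | loopFalse _ => exact fun _ _ => rfl

/-- Started in `σ`, the program `P` halts within its cost bound for registers of `B` bits and loops of
`L` iterations, in a memory with registers of `B` bits that satisfies `Q`. -/
def WP (B L : ℕ) (P : Prog) (Q : Memory → Prop) (σ : Memory) : Prop :=
  ∃ c τ, Exec P σ c τ ∧ c ≤ P.costWeight L * (B + 1) ∧ Bounded B τ ∧ Q τ

variable {B L : ℕ} {σ : Memory} {Q R : Memory → Prop}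

theorem Bounded.mono {b : ℕ} (h : Bounded b σ) (hb : b ≤ B) : Bounded B σ :=
  fun a i => (h a i).trans_le (Nat.pow_le_pow_right (by norm_num) hb)

theorem Bounded.write (h : Bounded B σ) {a i v : ℕ} (hv : v < 2 ^ B) : Bounded B (write σ a i v) := by
  intro a' i'
  unfold RAM.write
  split_ifs
  exacts [hv, h _ _]

theorem WP.mono {P : Prog} (h : WP B L P Q σ)
    (hQ : ∀ τ, Bounded B τ → (∀ a, a ∉ P.writes → τ a = σ a) → Q τ → R τ) : WP B L P R σ := by
  obtain ⟨c, τ, hx, hc, hb, hq⟩ := h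
  exact ⟨c, τ, hx, hc, hb, hQ τ hb hx.frame hq⟩

theorem WP.skip (hσ : Bounded B σ) (h : Q σ) : WP B L .skip Q σ :=
  ⟨1, σ, .skip σ, by simp [Prog.costWeight], hσ, h⟩

theorem WP.set (hσ : Bounded B σ) {a : ℕ} {i e : Expr} (hv : e.eval σ < 2 ^ B)
    (h : Q (write σ a (i.eval σ) (e.eval σ))) : WP B L (.set a i e) Q σ := by
  refine ⟨_, _, .set a i e σ, ?_, hσ.write hv, h⟩
  have h₁ := i.cost_le hσ
  have h₂ := e.cost_le hσ
  simp only [Prog.costWeight]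
  nlinarith

theorem WP.seq {P₁ P₂ : Prog} (h₁ : WP B L P₁ Q σ)
    (h₂ : ∀ τ, Bounded B τ → (∀ a, a ∉ P₁.writes → τ a = σ a) → Q τ → WP B L P₂ R τ) :
    WP B L (.seq P₁ P₂) R σ := by
  obtain ⟨c₁, τ₁, hx₁, hc₁, hb₁, hq₁⟩ := h₁
  obtain ⟨c₂, τ₂, hx₂, hc₂, hb₂, hq₂⟩ := h₂ τ₁ hb₁ hx₁.frame hq₁
  refine ⟨_, τ₂, .seq hx₁ hx₂, ?_, hb₂, hq₂⟩
  simp only [Prog.costWeight, add_mul]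
  exact add_le_add hc₁ hc₂

theorem WP.set_seq (hσ : Bounded B σ) {a : ℕ} {i e : Expr} {P : Prog} (hv : e.eval σ < 2 ^ B)
    (h : Bounded B (write σ a (i.eval σ) (e.eval σ)) →
      WP B L P Q (write σ a (i.eval σ) (e.eval σ))) : WP B L (.seq (.set a i e) P) Q σ :=
  WP.seq (Q := fun τ => τ = write σ a (i.eval σ) (e.eval σ)) (WP.set hσ hv rfl)
    fun τ hb _ hq => by subst hq; exact h hb

theorem WP.ite (hσ : Bounded B σ) {e : Expr} {P₁ P₂ : Prog} (h₁ : e.eval σ ≠ 0 → WP B L P₁ Q σ)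
    (h₂ : e.eval σ = 0 → WP B L P₂ Q σ) : WP B L (.ite e P₁ P₂) Q σ := by
  have he := e.cost_le hσ
  by_cases h : e.eval σ = 0
  · obtain ⟨c, τ, hx, hc, hb, hq⟩ := h₂ h
    refine ⟨_, τ, .iteFalse h hx, ?_, hb, hq⟩
    simp only [Prog.costWeight]
    nlinarith [Nat.zero_le (P₁.costWeight L * (B + 1))]
  · obtain ⟨c, τ, hx, hc, hb, hq⟩ := h₁ h
    refine ⟨_, τ, .iteTrue h hx, ?_, hb, hq⟩
    simp only [Prog.costWeight]
    nlinarith [Nat.zero_le (P₂.costWeight L * (B + 1))]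

/-- The scalar variable `a`: register `0` of array `a`. -/
abbrev Expr.var (a : ℕ) : Expr := .get a (.lit 0)

/-- Assignment to the scalar variable `a`. -/
abbrev Prog.assign (a : ℕ) (e : Expr) : Prog := .set a (.lit 0) e

/-- Let the scalar variable `i` run through the numbers below the scalar variable `b`. -/
def Prog.for (i b : ℕ) (P : Prog) : Prog :=
  .seq (.assign i (.lit 0)) (.loop (.sub (.var b) (.var i))
    (.seq P (.assign i (.add (.var i) (.lit 1)))))

/-- The body writes neither counter nor bound, so it runs exactly `N` times. The invariant is
required of the memory after the counter has been incremented, as this is where the next iteration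
starts. -/
theorem WP.for {i b N : ℕ} {P : Prog} (Inv : ℕ → Memory → Prop) (hσ : Bounded B σ)
    (hi : i ∉ P.writes) (hb : b ∉ P.writes) (hib : b ≠ i) (hN : σ b 0 = N) (hL : N ≤ L)
    (h₀ : Inv 0 (write σ i 0 0))
    (hstep : ∀ k τ, k < N → Bounded B τ → τ i 0 = k →
      (∀ a, a ≠ i → a ∉ P.writes → τ a = σ a) → Inv k τ →
      WP B L P (fun τ' => Inv (k + 1) (write τ' i 0 (k + 1))) τ) :
    WP B L (.for i b P) (Inv N) σ := by
  have hNB : N < 2 ^ B := hN ▸ hσ b 0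
  set e : Expr := .sub (.var b) (.var i) with he
  set S : Prog := .seq P (.assign i (.add (.var i) (.lit 1))) with hS
  -- Induction on the number `r` of remaining iterations; the last `e.costWeight` pays for the
  -- final, failing test.
  have key : ∀ r k τ, k + r = N → Bounded B τ → τ i 0 = k →
      (∀ a, a ≠ i → a ∉ P.writes → τ a = σ a) → Inv k τ →
      ∃ c τ', Exec (.loop e S) τ c τ' ∧
        c ≤ (r * (e.costWeight + S.costWeight L) + e.costWeight) * (B + 1) ∧
        Bounded B τ' ∧ Inv N τ' := by
    intro r
    induction r with
    | zero =>
      intro k τ hk hτ hτi hfr hinv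
      obtain rfl : k = N := by omega
      refine ⟨_, τ, .loopFalse ?_, ?_, hτ, hinv⟩
      · simp [he, Expr.eval, hfr b hib hb, hN, hτi]
      · simpa using e.cost_le hτ
    | succ r ih =>
      intro k τ hk hτ hτi hfr hinv
      obtain ⟨c₁, τ₁, hx₁, hc₁, hb₁, hq₁⟩ := hstep k τ (by omega) hτ hτi hfr hinv
      have hi₁ : τ₁ i 0 = k := by rw [hx₁.frame i hi, hτi]
      have hval : (Expr.add (.var i) (.lit 1)).eval τ₁ = k + 1 := by simp [Expr.eval, hi₁]
      have hlt : k + 1 < 2 ^ B := by omega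
      have hx₂ := Exec.set i (.lit 0) (.add (.var i) (.lit 1)) τ₁
      rw [hval] at hx₂
      have hx := Exec.seq hx₁ hx₂
      obtain ⟨c₃, τ₃, hx₃, hc₃, hb₃, hq₃⟩ := ih (k + 1) (write τ₁ i 0 (k + 1)) (by omega)
        (hb₁.write hlt) (by simp [write])
        (fun a ha ha' => by
          have : write τ₁ i 0 (k + 1) a = τ₁ a := by funext j; simp [write, ha]
          rw [this, hx₁.frame a ha', hfr a ha ha']) hq₁
      refine ⟨_, τ₃, .loopTrue ?_ hx hx₃, ?_, hb₃, hq₃⟩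
      · simp only [he, Expr.eval, hfr b hib hb, hN, hτi]
        omega
      · have h₁ := e.cost_le hτ
        have h₂ := (Expr.lit 0).cost_le hb₁
        have h₄ := (Expr.add (.var i) (.lit 1)).cost_le hb₁
        have : S.costWeight L = P.costWeight L + ((Expr.lit 0).costWeight +
          (Expr.add (.var i) (.lit 1)).costWeight + 1) := rfl
        rw [this] at hc₃ ⊢
        nlinarith
  obtain ⟨c, τ, hx, hc, hbd, hq⟩ := key N 0 (write σ i 0 0) (by omega)
    (hσ.write (by positivity)) (by simp [write])
    (fun a ha _ => by funext j; simp [write, ha]) h₀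
  refine ⟨_, τ, .seq (.set i (.lit 0) (.lit 0) σ) hx, ?_, hbd, hq⟩
  have h₂ := (Expr.lit 0).cost_le hσ
  have : (Prog.for i b P).costWeight L = ((Expr.lit 0).costWeight + (Expr.lit 0).costWeight + 1) +
      (L + 1) * (e.costWeight + S.costWeight L) := rfl
  rw [this]
  have h₃ : N * (e.costWeight + S.costWeight L) ≤ L * (e.costWeight + S.costWeight L) :=
    Nat.mul_le_mul_right _ hL
  have h₄ : N * (e.costWeight + S.costWeight L) + e.costWeight ≤
      (L + 1) * (e.costWeight + S.costWeight L) := by nlinarith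
  have h₅ := Nat.mul_le_mul_right (B + 1) h₄
  nlinarith

end RAM

/-! ### The program -/

namespace RAM

instance : Add Expr := ⟨.add⟩
instance : Sub Expr := ⟨.sub⟩
instance : Mul Expr := ⟨.mul⟩
instance : Div Expr := ⟨.div⟩
instance (n : ℕ) : OfNat Expr n := ⟨.lit n⟩

section

variable (σ : Memory) (e₁ e₂ : Expr)

@[simp] theorem Expr.eval_add : (e₁ + e₂).eval σ = e₁.eval σ + e₂.eval σ := rfl
@[simp] theorem Expr.eval_sub : (e₁ - e₂).eval σ = e₁.eval σ - e₂.eval σ := rfl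
@[simp] theorem Expr.eval_mul : (e₁ * e₂).eval σ = e₁.eval σ * e₂.eval σ := rfl
@[simp] theorem Expr.eval_div : (e₁ / e₂).eval σ = e₁.eval σ / e₂.eval σ := rfl
@[simp] theorem Expr.eval_ofNat (n : ℕ) : Expr.eval σ (no_index (OfNat.ofNat n)) = n := rfl
@[simp] theorem Expr.eval_lit (n : ℕ) : Expr.eval σ (.lit n) = n := rfl
@[simp] theorem Expr.eval_get (a : ℕ) : (Expr.get a e₁).eval σ = σ a (e₁.eval σ) := rfl

end

infixr:60 " ;; " => Prog.seq

-- Notations for numerals, so that `decide` settles membership in `writes`. Arrays below `18` other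
-- than `rOut` are written only before the candidates are treated.
notation "rIn" => (0 : ℕ)
notation "rOut" => (1 : ℕ)
notation "rK" => (2 : ℕ)
notation "rN₁" => (3 : ℕ)
notation "rN₂" => (4 : ℕ)
notation "rM₀" => (5 : ℕ)
notation "rHead" => (6 : ℕ)
notation "rCount" => (7 : ℕ)
notation "rDen" => (8 : ℕ)
notation "rQ" => (9 : ℕ)
notation "rOff" => (10 : ℕ)
notation "rE" => (11 : ℕ)
notation "rPos" => (12 : ℕ)
notation "rNom" => (13 : ℕ)
notation "rAlt" => (14 : ℕ)
notation "rT" => (15 : ℕ)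
notation "rKN" => (16 : ℕ)
notation "rTotal" => (17 : ℕ)
notation "rBest" => (18 : ℕ)
notation "rC" => (19 : ℕ)
notation "rX" => (20 : ℕ)
notation "rItem" => (21 : ℕ)
notation "rTerm" => (22 : ℕ)
notation "rInit" => (23 : ℕ)
notation "rC₁" => (24 : ℕ)
notation "rC₂" => (25 : ℕ)
notation "rS" => (26 : ℕ)
notation "rA" => (27 : ℕ)
notation "rU" => (28 : ℕ)
notation "rMs" => (29 : ℕ)
notation "rIdx" => (30 : ℕ)
notation "rGain" => (31 : ℕ)
notation "rRest" => (32 : ℕ)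
notation "rAcc" => (33 : ℕ)
notation "rBig" => (34 : ℕ)
notation "rMax" => (35 : ℕ)
notation "rRound" => (36 : ℕ)
notation "rVal" => (37 : ℕ)
notation "rArg" => (38 : ℕ)
notation "rCell" => (39 : ℕ)
notation "rCand" => (40 : ℕ)
notation "rY" => (41 : ℕ)
notation "rPol" => (42 : ℕ)
notation "rSumG" => (43 : ℕ)
notation "rSumR" => (44 : ℕ)
notation "rScore" => (45 : ℕ)
notation "rI" => (46 : ℕ)
notation "rH" => (47 : ℕ)

open RAM.Expr RAM.Prog

/-- Read the header, scale all rationals to a common denominator and compute the offsets. -/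
def prepare : Prog :=
  -- Register `0` of the input holds its length, registers `1` to `3` the sizes, the next `n₁` the
  -- numbers of actions; from register `n₁ + 4` on, numerators and denominators alternate.
  assign rN₁ (get rIn 1) ;; assign rN₂ (get rIn 2) ;; assign rM₀ (get rIn 3) ;;
  assign rHead (var rN₁ + 4) ;; assign rCount ((get rIn 0 - (var rN₁ + 3)) / 2) ;;
  assign rDen 1 ;;
  Prog.for rI rCount
    (assign rDen (var rDen * get rIn (var rHead + (2 * var rI + 1)))) ;;
  Prog.for rI rCount
    (set rQ (var rI) (get rIn (var rHead + 2 * var rI) *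
      (var rDen / get rIn (var rHead + (2 * var rI + 1))))) ;;
  Prog.for rS rN₁ (set rOff (var rS + 1) (get rOff (var rS) + get rIn (var rS + 4))) ;;
  assign rE (get rOff (var rN₁)) ;; assign rPos (var rM₀ * var rN₁) ;;
  assign rNom (var rPos + var rE * var rN₂) ;; assign rAlt (var rNom + var rN₂) ;;
  assign rKN (var rK * var rN₁) ;; assign rT (var rKN * var rN₁ + 1) ;;
  assign rTotal (var rM₀ * var rN₂ * var rE * var rT) ;;
  assign rOut (var rN₁ + 1)

/-- Decode the number of a candidate. -/
def decodeCandidate : Prog :=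
  assign rC₁ (var rC / var rT) ;; assign rX (var rC - var rC₁ * var rT) ;;
  assign rC₂ (var rC₁ / var rE) ;; assign rItem (var rC₁ - var rC₂ * var rE) ;;
  assign rInit (var rC₂ / var rN₂) ;; assign rTerm (var rC₂ - var rInit * var rN₂)

/-- The gain and the rest of one state-action pair. -/
def tableCell : Prog :=
  assign rIdx (get rOff (var rS) + var rA) ;; assign rAcc 0 ;;
  Prog.for rU rN₂
    (assign rAcc (var rAcc + get rQ (var rPos + (var rIdx * var rN₂ + var rU)) *
      get rQ (var rNom + var rU))) ;;
  set rGain (var rIdx) (get rQ (var rInit * var rN₁ + var rS) *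
    get rQ (var rPos + (var rIdx * var rN₂ + var rTerm)) *
    (get rQ (var rNom + var rTerm) - get rQ (var rAlt + var rTerm))) ;;
  set rRest (var rIdx) (get rQ (var rInit * var rN₁ + var rS) * var rAcc -
    get rGain (var rIdx)) ;;
  assign rBig (var rBig + get rRest (var rIdx))

/-- The gains and the rests of all state-action pairs. -/
def table : Prog :=
  assign rBig 1 ;;
  Prog.for rS rN₁ (assign rMs (get rIn (var rS + 4)) ;; Prog.for rA rMs tableCell)

/-- Round the gains. -/
def roundGains : Prog :=
  assign rMax (get rGain (var rItem)) ;;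
  Prog.for rI rE (set rRound (var rI)
    -- In truncated subtraction `x - (x - M)` is `min x M`. Clipping keeps each rounded gain at most
    -- `K n₁`, and only underestimates policies with larger gains.
    ((get rGain (var rI) - (get rGain (var rI) - var rMax)) * var rKN / var rMax))

/-- One entry of the table of the dynamic program. -/
def dpCell : Prog :=
  -- Row `s + 1` of the values is written, at distance `T` behind row `s`; the chosen action is kept
  -- in row `s` of `rArg`.
  assign rCell (var rS * var rT + var rH) ;; set rVal (var rCell + var rT) 0 ;;
  set rArg (var rCell) 0 ;;
  Prog.for rA rMs
    (assign rIdx (get rOff (var rS) + var rA) ;;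
     assign rCand (get rVal (var rS * var rT + (var rH - get rRound (var rIdx))) +
       get rRest (var rIdx)) ;;
     Prog.ite (var rCand - get rVal (var rCell + var rT))
       (set rVal (var rCell + var rT) (var rCand) ;; set rArg (var rCell) (var rA)) Prog.skip)

/-- The dynamic program. -/
def dp : Prog :=
  -- In the base row only target `0` is met, so only its entry carries the bonus `rBig`, which
  -- replaces a value `-∞` for unreachable targets.
  Prog.for rI rT (set rVal (var rI) 0) ;; set rVal 0 (var rBig) ;;
  Prog.for rS rN₁ (assign rMs (get rIn (var rS + 4)) ;; Prog.for rH rT dpCell)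

/-- Reconstruct the policy of a final entry of the dynamic program. -/
def reconstruct : Prog :=
  set rY (var rN₁) (var rX) ;;
  Prog.for rI rN₁
    (assign rS (var rN₁ - 1 - var rI) ;;
     set rPol (var rS) (get rArg (var rS * var rT + get rY (var rS + 1))) ;;
     set rY (var rS) (get rY (var rS + 1) -
       get rRound (get rOff (var rS) + get rPol (var rS))))

/-- The score of the reconstructed policy. -/
def evaluate : Prog :=
  assign rSumG 0 ;; assign rSumR 0 ;;
  Prog.for rS rN₁
    (assign rIdx (get rOff (var rS) + get rPol (var rS)) ;;
     assign rSumG (var rSumG + get rGain (var rIdx)) ;;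
     assign rSumR (var rSumR + get rRest (var rIdx))) ;;
  assign rScore (var rSumG - (var rSumG - var rSumR))

/-- Keep the reconstructed policy if it has a better score. -/
def keepBest : Prog :=
  Prog.ite (var rScore - var rBest)
    (assign rBest (var rScore) ;; set rOut 1 (var rInit) ;;
     Prog.for rS rN₁ (set rOut (var rS + 2) (get rPol (var rS))))
    Prog.skip

/-- Treat one candidate. -/
def candidate : Prog :=
  decodeCandidate ;; table ;; roundGains ;; dp ;; reconstruct ;; evaluate ;; keepBest

/-- The approximation scheme with precision `K`. -/
def scheme (K : ℕ) : Prog := assign rK (.lit K) ;; prepare ;; Prog.for rC rTotal candidate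

end RAM

/-! ### Scaled instances -/

/-- A two-stage instance in which all rational numbers are scaled to integers, with the precision of
the dynamic program.  The numbers `q` are arranged as in the encoding of the instance. -/
structure ScaledInstance : Type where
  K : ℕ
  n₁ : ℕ
  n₂ : ℕ
  m₀ : ℕ
  m : ℕ → ℕ
  q : ℕ → ℕ

namespace ScaledInstance

variable (d : ScaledInstance)

/-- The number of state-action pairs before state `s`. -/
def off (s : ℕ) : ℕ := ∑ s' ∈ Finset.range s, d.m s'

/-- The number of state-action pairs. -/
def E : ℕ := d.off d.n₁

/-- The position of the second-stage probabilities. -/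
def pos : ℕ := d.m₀ * d.n₁

/-- The position of the nominal rewards. -/
def nom : ℕ := d.pos + d.E * d.n₂

/-- The position of the alternative rewards. -/
def alt : ℕ := d.nom + d.n₂

/-- The number of sums of rounded gains. -/
def T : ℕ := d.K * d.n₁ * d.n₁ + 1

/-- The number of candidates. -/
def total : ℕ := d.m₀ * d.n₂ * d.E * d.T

/-- The contribution of action `a` at state `s` to the possible loss at terminal state `t`. -/
def gain (a₀ t s a : ℕ) : ℕ :=
  d.q (a₀ * d.n₁ + s) * d.q (d.pos + ((d.off s + a) * d.n₂ + t)) * (d.q (d.nom + t) - d.q (d.alt + t))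

/-- The scaled expected reward of action `a` at state `s`. -/
def mean (s a : ℕ) : ℕ :=
  ∑ u ∈ Finset.range d.n₂, d.q (d.pos + ((d.off s + a) * d.n₂ + u)) * d.q (d.nom + u)

/-- The contribution of action `a` at state `s` to the reward that remains after a loss at `t`. -/
def rest (a₀ t s a : ℕ) : ℕ := d.q (a₀ * d.n₁ + s) * d.mean s a - d.gain a₀ t s a

/-- The smaller one of the total gain and the total rest. -/
def score (a₀ t : ℕ) (π : ℕ → ℕ) : ℕ :=
  min (∑ s ∈ Finset.range d.n₁, d.gain a₀ t s (π s)) (∑ s ∈ Finset.range d.n₁, d.rest a₀ t s (π s))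

/-- A function that chooses an action at each state. -/
def IsPolicy (π : ℕ → ℕ) : Prop := ∀ s < d.n₁, π s < d.m s

theorem score_congr (a₀ t : ℕ) {π π' : ℕ → ℕ} (h : ∀ s < d.n₁, π s = π' s) :
    d.score a₀ t π = d.score a₀ t π' := by
  have h₁ : ∀ f : ℕ → ℕ → ℕ, ∑ s ∈ Finset.range d.n₁, f s (π s) =
      ∑ s ∈ Finset.range d.n₁, f s (π' s) := fun f =>
    Finset.sum_congr rfl fun s hs => by rw [h s (Finset.mem_range.1 hs)]
  rw [score, score, h₁, h₁]

/-- Bounds for the data of the instance. -/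
structure Fits (b L : ℕ) : Prop where
  q_lt : ∀ j, d.q j < 2 ^ b
  n₁_lt : d.n₁ < 2 ^ b
  n₂_lt : d.n₂ < 2 ^ b
  E_lt : d.E < 2 ^ b
  KN_lt : d.K * d.n₁ < 2 ^ b
  T_lt : d.T < 2 ^ b
  total_lt : d.total < 2 ^ b
  n₁_le : d.n₁ ≤ L
  n₂_le : d.n₂ ≤ L
  E_le : d.E ≤ L
  T_le : d.T ≤ L
  total_le : d.total ≤ L

variable {d}

theorem off_succ (s : ℕ) : d.off (s + 1) = d.off s + d.m s := Finset.sum_range_succ _ _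

theorem off_mono {s s' : ℕ} (h : s ≤ s') : d.off s ≤ d.off s' :=
  Finset.sum_le_sum_of_subset (Finset.range_mono h)

theorem off_add_lt {s s' a : ℕ} (hs : s < s') (ha : a < d.m s) : d.off s + a < d.off s' :=
  calc d.off s + a < d.off s + d.m s := by omega
    _ = d.off (s + 1) := (off_succ s).symm
    _ ≤ d.off s' := off_mono hs

theorem m_le_E {s : ℕ} (hs : s < d.n₁) : d.m s ≤ d.E :=
  Finset.single_le_sum (f := d.m) (fun _ _ => Nat.zero_le _) (Finset.mem_range.2 hs)

variable {b L : ℕ}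

theorem Fits.gain_lt (h : d.Fits b L) (a₀ t s a : ℕ) : d.gain a₀ t s a < 2 ^ (3 * b) := by
  have : 2 ^ (3 * b) = 2 ^ b * 2 ^ b * 2 ^ b := by ring
  rw [this]
  exact Nat.mul_lt_mul'' (Nat.mul_lt_mul'' (h.q_lt _) (h.q_lt _))
    ((Nat.sub_le _ _).trans_lt (h.q_lt _))

theorem Fits.partialMean_lt (h : d.Fits b L) (s a : ℕ) {k : ℕ} (hk : k ≤ d.n₂) :
    ∑ u ∈ Finset.range k, d.q (d.pos + ((d.off s + a) * d.n₂ + u)) * d.q (d.nom + u) <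
      2 ^ (3 * b) := by
  have h₁ : ∑ u ∈ Finset.range k, d.q (d.pos + ((d.off s + a) * d.n₂ + u)) * d.q (d.nom + u) ≤
      k * (2 ^ b * 2 ^ b) := by
    simpa using Finset.sum_le_card_nsmul (Finset.range k) _ (2 ^ b * 2 ^ b)
      fun u _ => Nat.mul_le_mul (h.q_lt _).le (h.q_lt _).le
  have h₂ : k * (2 ^ b * 2 ^ b) < 2 ^ b * (2 ^ b * 2 ^ b) :=
    Nat.mul_lt_mul_of_pos_right (hk.trans_lt h.n₂_lt) (by positivity)
  have : 2 ^ (3 * b) = 2 ^ b * (2 ^ b * 2 ^ b) := by ring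
  omega

theorem Fits.rest_lt (h : d.Fits b L) (a₀ t s a : ℕ) : d.rest a₀ t s a < 2 ^ (4 * b) := by
  have : 2 ^ (4 * b) = 2 ^ b * 2 ^ (3 * b) := by ring
  rw [this]
  exact (Nat.sub_le _ _).trans_lt (Nat.mul_lt_mul'' (h.q_lt _) (h.partialMean_lt s a le_rfl))

end ScaledInstance

/-! ### Correctness of the subroutines: decoding, gains and rests, rounding -/

namespace RAM

open ScaledInstance

/-- The memory `σ` holds the scaled instance `d` after the preparation. -/
structure Ready (d : ScaledInstance) (σ : Memory) : Prop where
  m : ∀ s, σ rIn (s + 4) = d.m s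
  K : σ rK 0 = d.K
  n₁ : σ rN₁ 0 = d.n₁
  n₂ : σ rN₂ 0 = d.n₂
  m₀ : σ rM₀ 0 = d.m₀
  q : ∀ j, σ rQ j = d.q j
  off : ∀ s ≤ d.n₁, σ rOff s = d.off s
  E : σ rE 0 = d.E
  pos : σ rPos 0 = d.pos
  nom : σ rNom 0 = d.nom
  alt : σ rAlt 0 = d.alt
  T : σ rT 0 = d.T
  KN : σ rKN 0 = d.K * d.n₁
  total : σ rTotal 0 = d.total

variable {d : ScaledInstance} {σ τ : Memory} {b L : ℕ}

theorem Ready.congr (h : Ready d σ) (hτ : ∀ a < 18, a ≠ rOut → τ a = σ a) : Ready d τ := by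
  constructor
  · rw [hτ rIn (by norm_num) (by norm_num)]; exact h.m
  · rw [hτ rK (by norm_num) (by norm_num)]; exact h.K
  · rw [hτ rN₁ (by norm_num) (by norm_num)]; exact h.n₁
  · rw [hτ rN₂ (by norm_num) (by norm_num)]; exact h.n₂
  · rw [hτ rM₀ (by norm_num) (by norm_num)]; exact h.m₀
  · rw [hτ rQ (by norm_num) (by norm_num)]; exact h.q
  · rw [hτ rOff (by norm_num) (by norm_num)]; exact h.off
  · rw [hτ rE (by norm_num) (by norm_num)]; exact h.E
  · rw [hτ rPos (by norm_num) (by norm_num)]; exact h.pos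
  · rw [hτ rNom (by norm_num) (by norm_num)]; exact h.nom
  · rw [hτ rAlt (by norm_num) (by norm_num)]; exact h.alt
  · rw [hτ rT (by norm_num) (by norm_num)]; exact h.T
  · rw [hτ rKN (by norm_num) (by norm_num)]; exact h.KN
  · rw [hτ rTotal (by norm_num) (by norm_num)]; exact h.total

end RAM

namespace RAM

open ScaledInstance

variable {d : ScaledInstance} {σ τ : Memory} {b B L : ℕ}

/-- The candidate number is a mixed-radix numeral with the digits initial action, terminal state,
state-action pair and target. -/
theorem WP.decodeCandidate (hσ : Bounded B σ) (hd : Ready d σ) :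
    WP B L decodeCandidate (fun τ => τ rX 0 = σ rC 0 % d.T ∧ τ rItem 0 = σ rC 0 / d.T % d.E ∧
      τ rTerm 0 = σ rC 0 / d.T / d.E % d.n₂ ∧ τ rInit 0 = σ rC 0 / d.T / d.E / d.n₂) σ := by
  have hC := hσ rC 0
  have hmod : ∀ x y : ℕ, x - x / y * y = x % y := fun x y => by
    have := Nat.div_add_mod' x y
    omega
  have h₁ : σ rC 0 / d.T < 2 ^ B := (Nat.div_le_self _ _).trans_lt hC
  have h₂ : σ rC 0 / d.T / d.E < 2 ^ B := (Nat.div_le_self _ _).trans_lt h₁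
  have h₃ : σ rC 0 / d.T / d.E / d.n₂ < 2 ^ B := (Nat.div_le_self _ _).trans_lt h₂
  have hT := hd.T
  have hE := hd.E
  have hn₂ := hd.n₂
  unfold RAM.decodeCandidate
  refine WP.set_seq hσ (by simp [hT, h₁]) fun hσ => ?_
  refine WP.set_seq hσ (by simpa [write, hT] using (Nat.sub_le _ _).trans_lt hC) fun hσ => ?_
  refine WP.set_seq hσ (by simpa [write, hT, hE] using h₂) fun hσ => ?_
  refine WP.set_seq hσ (by simpa [write, hT, hE] using (Nat.sub_le _ _).trans_lt h₁) fun hσ => ?_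
  refine WP.set_seq hσ (by simpa [write, hT, hE, hn₂] using h₃) fun hσ => ?_
  refine WP.set hσ (by simpa [write, hT, hE, hn₂] using (Nat.sub_le _ _).trans_lt h₂) ?_
  simp [write, hT, hE, hn₂, hmod]

/-- The clauses on the other entries let the enclosing loops accumulate the table; `hbig` leaves
room for one more summand in the bonus. -/
theorem WP.tableCell (hB : 4 * b ≤ B) (hL : d.Fits b L) (hσ : Bounded B σ) (hd : Ready d σ)
    {a₀ t s a : ℕ} (hs : s < d.n₁) (ha : a < d.m s) (hS : σ rS 0 = s) (hA : σ rA 0 = a)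
    (hI : σ rInit 0 = a₀) (ht : σ rTerm 0 = t) (hbig : σ rBig 0 + 2 ^ (4 * b) ≤ 2 ^ B) :
    WP B L tableCell (fun τ =>
      τ rGain (d.off s + a) = d.gain a₀ t s a ∧ τ rRest (d.off s + a) = d.rest a₀ t s a ∧
      (∀ j, j ≠ d.off s + a → τ rGain j = σ rGain j) ∧
      (∀ j, j ≠ d.off s + a → τ rRest j = σ rRest j) ∧
      τ rBig 0 = σ rBig 0 + d.rest a₀ t s a) σ := by
  have hidx : d.off s + a < 2 ^ b := (off_add_lt hs ha).trans hL.E_lt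
  have hbB : 2 ^ b ≤ 2 ^ B := Nat.pow_le_pow_right (by norm_num) (by omega)
  have h3B : 2 ^ (3 * b) ≤ 2 ^ B := Nat.pow_le_pow_right (by norm_num) (by omega)
  have h4B : 2 ^ (4 * b) ≤ 2 ^ B := Nat.pow_le_pow_right (by norm_num) (by omega)
  have hoff := hd.off s hs.le
  unfold RAM.tableCell
  refine WP.set_seq hσ (by simp [hS, hA, hoff]; omega) fun hσ => ?_
  refine WP.set_seq hσ (by simp) fun hσ => ?_
  simp only [Expr.eval_get, Expr.eval_lit, hS, hA, hoff, Expr.eval_add,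
    Expr.eval_ofNat] at hσ ⊢
  set σ₁ := write (write σ rIdx 0 (d.off s + a)) rAcc 0 0 with hσ₁
  have fr : ∀ a, a ≠ rIdx → a ≠ rAcc → σ₁ a = σ a := fun a h₁ h₂ => by
    funext j; simp [hσ₁, write, h₁, h₂]
  have hd₁ : Ready d σ₁ := hd.congr fun a ha _ => fr a (by omega) (by omega)
  have hidx₁ : σ₁ rIdx 0 = d.off s + a := by simp [hσ₁, write]
  refine WP.seq (WP.for (N := d.n₂) (fun k τ => τ rAcc 0 = ∑ u ∈ Finset.range k,
    d.q (d.pos + ((d.off s + a) * d.n₂ + u)) * d.q (d.nom + u)) hσ (by decide) (by decide)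
    (by decide) hd₁.n₂ hL.n₂_le (by simp [hσ₁, write]) ?_) ?_
  · intro k τ hk hτ hu hf hacc
    have hdτ : Ready d τ := hd₁.congr fun a ha _ =>
      hf a (by omega) (by simp [Prog.writes]; omega)
    have hidxτ : τ rIdx 0 = d.off s + a := by rw [hf rIdx (by decide) (by decide), hidx₁]
    have hval : ∑ u ∈ Finset.range (k + 1), d.q (d.pos + ((d.off s + a) * d.n₂ + u)) *
        d.q (d.nom + u) < 2 ^ B := (hL.partialMean_lt s a (by omega)).trans_le h3B
    rw [Finset.sum_range_succ] at hval
    refine WP.set hτ ?_ ?_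
    · simpa [hidxτ, hdτ.pos, hdτ.n₂, hdτ.q, hdτ.nom, hu, hacc] using hval
    · simp [write, hidxτ, hdτ.pos, hdτ.n₂, hdτ.q, hdτ.nom, hu, hacc, Finset.sum_range_succ]
  · intro τ hτ hf hacc
    have fr₂ : ∀ a, a ≠ rIdx → a ≠ rAcc → a ≠ rU → τ a = σ a := fun a h₁ h₂ h₃ => by
      rw [hf a (by simp [Prog.for, Prog.writes, h₂, h₃]), fr a h₁ h₂]
    have hdτ : Ready d τ := hd.congr fun a ha _ => fr₂ a (by omega) (by omega) (by omega)
    have hidxτ : τ rIdx 0 = d.off s + a := by rw [hf rIdx (by decide), hidx₁]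
    have hSτ : τ rS 0 = s := by rw [fr₂ _ (by decide) (by decide) (by decide), hS]
    have hIτ : τ rInit 0 = a₀ := by rw [fr₂ _ (by decide) (by decide) (by decide), hI]
    have htτ : τ rTerm 0 = t := by rw [fr₂ _ (by decide) (by decide) (by decide), ht]
    have hgain := (hL.gain_lt a₀ t s a).trans_le h3B
    have hrest := hL.rest_lt a₀ t s a
    have hgainE : σ rGain = τ rGain := (fr₂ _ (by decide) (by decide) (by decide)).symm
    have hrestE : σ rRest = τ rRest := (fr₂ _ (by decide) (by decide) (by decide)).symm
    have hbigE : σ rBig = τ rBig := (fr₂ _ (by decide) (by decide) (by decide)).symm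
    rw [hbigE] at hbig
    rw [hgainE, hrestE, hbigE]
    change τ rAcc 0 = d.mean s a at hacc
    have hE₁ : (Expr.get rQ (.var rInit * .var rN₁ + .var rS) *
        .get rQ (.var rPos + (.var rIdx * .var rN₂ + .var rTerm)) *
        (.get rQ (.var rNom + .var rTerm) - .get rQ (.var rAlt + .var rTerm))).eval τ =
        d.gain a₀ t s a := by
      simp [hidxτ, hdτ.pos, hdτ.n₂, hdτ.n₁, hdτ.q, hdτ.nom, hdτ.alt, hSτ, hIτ, htτ, gain]
    refine WP.set_seq hτ (by rwa [hE₁]) fun hτ => ?_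
    rw [hE₁] at hτ ⊢
    have hE₂ : (Expr.get rQ (.var rInit * .var rN₁ + .var rS) * .var rAcc -
        .get rGain (.var rIdx)).eval (write τ rGain ((Expr.var rIdx).eval τ) (d.gain a₀ t s a)) =
        d.rest a₀ t s a := by
      simp [write, hidxτ, hdτ.n₁, hdτ.q, hSτ, hIτ, rest, hacc]
    refine WP.set_seq hτ (by rw [hE₂]; omega) fun hτ => ?_
    rw [hE₂] at hτ ⊢
    refine WP.set hτ ?_ ?_
    · simp [write, hidxτ]
      omega
    · simp +contextual [write, hidxτ]

/-- The bonus is one plus the rests of all state-action pairs, and a policy uses only one pair per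
state, so the bonus exceeds its total rest. -/
theorem WP.table (hB : 5 * b + 1 ≤ B) (hL : d.Fits b L) (hσ : Bounded B σ) (hd : Ready d σ)
    {a₀ t : ℕ} (hI : σ rInit 0 = a₀) (ht : σ rTerm 0 = t) :
    WP B L table (fun τ =>
      (∀ s < d.n₁, ∀ a < d.m s, τ rGain (d.off s + a) = d.gain a₀ t s a ∧
        τ rRest (d.off s + a) = d.rest a₀ t s a) ∧
      τ rBig 0 ≤ 1 + d.E * 2 ^ (4 * b) ∧
      ∀ π, d.IsPolicy π → ∑ s ∈ Finset.range d.n₁, d.rest a₀ t s (π s) < τ rBig 0) σ := by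
  have hbound : 1 + d.E * 2 ^ (4 * b) ≤ 2 ^ B := by
    have h₁ : 2 ^ (5 * b + 1) ≤ 2 ^ B := Nat.pow_le_pow_right (by norm_num) hB
    have h₂ : 2 ^ (5 * b + 1) = 2 ^ b * 2 ^ (4 * b) + 2 ^ b * 2 ^ (4 * b) := by ring
    have h₃ : d.E * 2 ^ (4 * b) ≤ 2 ^ b * 2 ^ (4 * b) := Nat.mul_le_mul_right _ hL.E_lt.le
    have h₄ : 0 < 2 ^ b * 2 ^ (4 * b) := by positivity
    omega
  let Rows : ℕ → Memory → Prop := fun s τ =>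
    (∀ s' < s, ∀ a < d.m s', τ rGain (d.off s' + a) = d.gain a₀ t s' a ∧
      τ rRest (d.off s' + a) = d.rest a₀ t s' a)
  let sumR : ℕ → ℕ := fun s =>
    ∑ s' ∈ Finset.range s, ∑ a ∈ Finset.range (d.m s'), d.rest a₀ t s' a
  have hsum : ∀ s a, ∑ a' ∈ Finset.range a, d.rest a₀ t s a' ≤ a * 2 ^ (4 * b) := fun s a => by
    simpa using Finset.sum_le_card_nsmul (Finset.range a) _ (2 ^ (4 * b))
      fun u _ => (hL.rest_lt a₀ t s u).le
  have hsumR : ∀ s, sumR s ≤ d.off s * 2 ^ (4 * b) := fun s => by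
    rw [off, Finset.sum_mul]
    exact Finset.sum_le_sum fun s' _ => hsum s' _
  unfold RAM.table
  refine WP.set_seq hσ (by simpa using Nat.one_lt_two_pow (n := B) (by omega)) fun hσ₁ => ?_
  simp only [Expr.eval_lit, Expr.eval_ofNat] at hσ₁ ⊢
  set σ₁ := write σ rBig 0 1 with hσ₁E
  have fr : ∀ a, a ≠ rBig → σ₁ a = σ a := fun a h₁ => by
    funext j; simp [hσ₁E, write, h₁]
  have hd₁ : Ready d σ₁ := hd.congr fun a ha _ => fr a (by omega)
  refine (WP.for (N := d.n₁) (fun s τ => Rows s τ ∧ τ rBig 0 = 1 + sumR s) hσ₁ (by decide)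
    (by decide) (by decide) hd₁.n₁ hL.n₁_le (by simp [Rows, sumR, write, hσ₁E]) ?_).mono ?_
  · rintro s τ hs hτ hS hf ⟨hrows, hbig⟩
    have hdτ : Ready d τ := hd₁.congr fun a ha h1 =>
      hf a (by omega) (by revert a; decide)
    have hEs : d.off s + d.m s ≤ d.E := by
      rw [← off_succ]; exact off_mono hs
    refine WP.set_seq hτ ?_ fun hτ₁ => ?_
    · simpa [hS, hdτ.m] using (m_le_E hs).trans_lt
        (hL.E_lt.trans_le (Nat.pow_le_pow_right (n := 2) (by norm_num) (by omega : b ≤ B)))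
    simp only [Expr.eval_lit, Expr.eval_get, Expr.eval_add, Expr.eval_ofNat, hS, hdτ.m] at hτ₁ ⊢
    set τ₁ := write τ rMs 0 (d.m s) with hτ₁E
    have fr₁ : ∀ a, a ≠ rMs → τ₁ a = τ a := fun a h₁ => by
      funext j; simp [hτ₁E, write, h₁]
    refine (WP.for (N := d.m s) (fun a ρ => Rows s ρ ∧
      (∀ a' < a, ρ rGain (d.off s + a') = d.gain a₀ t s a' ∧
        ρ rRest (d.off s + a') = d.rest a₀ t s a') ∧
      ρ rBig 0 = 1 + sumR s + ∑ a' ∈ Finset.range a, d.rest a₀ t s a') hτ₁ (by decide) (by decide)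
      (by decide) (by simp [hτ₁E, write]) ((m_le_E hs).trans hL.E_le) ?_ ?_).mono ?_
    · simpa [write, hτ₁E, Rows, hbig] using hrows
    · rintro a ρ ha hρ hA hfρ ⟨hrows, hrow, hbig⟩
      have hfr : ∀ j < 27, j ≠ 1 → j ≠ rBig → ρ j = τ j := fun j hj h1 h2 => by
        rw [hfρ j (by omega) (by revert j; decide), fr₁ j (by omega)]
      have hdρ : Ready d ρ := hdτ.congr fun j hj h1 => hfr j (by omega) h1 (by omega)
      have hinit : ρ rInit 0 = a₀ := by
        rw [hfr _ (by decide) (by decide) (by decide), hf _ (by decide) (by decide), fr _ (by decide),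
          hI]
      have hterm : ρ rTerm 0 = t := by
        rw [hfr _ (by decide) (by decide) (by decide), hf _ (by decide) (by decide), fr _ (by decide),
          ht]
      have hSρ : ρ rS 0 = s := by rw [hfr _ (by decide) (by decide) (by decide), hS]
      refine (WP.tableCell (by omega) hL hρ hdρ hs ha hSρ hA hinit hterm ?_).mono ?_
      · have h₁ := hsum s a
        have h₂ := hsumR s
        -- The pairs already summed, together with the current one, are among the `E` pairs.
        have h₃ : (d.off s + a + 1) * 2 ^ (4 * b) ≤ d.E * 2 ^ (4 * b) :=
          Nat.mul_le_mul_right _ (by omega)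
        rw [hbig]
        nlinarith
      · rintro ω hω hfω ⟨h₁, h₂, h₃, h₄, h₅⟩
        refine ⟨?_, ?_, ?_⟩
        · intro s' hs' a' ha'
          have hne : d.off s' + a' ≠ d.off s + a := by
            have := off_add_lt hs' ha'
            omega
          have := hrows s' hs' a' ha'
          simp only [write]
          simpa [h₃ _ hne, h₄ _ hne] using this
        · intro a' ha'
          rcases Nat.lt_succ_iff_lt_or_eq.1 ha' with h | rfl
          · have hne : d.off s + a' ≠ d.off s + a := by omega
            have := hrow a' h
            simpa [write, h₃ _ hne, h₄ _ hne] using this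
          · simp [write, h₁, h₂]
        · simp [write, h₅, hbig, Finset.sum_range_succ, add_assoc]
    · rintro ω hω hfω ⟨h₁, h₂, h₃⟩
      refine ⟨?_, ?_⟩
      · intro s' hs' a ha
        rcases Nat.lt_succ_iff_lt_or_eq.1 hs' with h | rfl
        · simpa [write] using h₁ s' h a ha
        · simpa [write] using h₂ a ha
      · simp [write, h₃, sumR, Finset.sum_range_succ, add_assoc]
  · rintro ω hω hfω ⟨h₁, h₂⟩
    refine ⟨h₁, ?_, ?_⟩
    · rw [h₂]
      exact Nat.add_le_add_left (hsumR _) 1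
    · intro π hπ
      rw [h₂, Nat.lt_one_add_iff]
      refine Finset.sum_le_sum fun s hs => ?_
      exact Finset.single_le_sum (f := fun a => d.rest a₀ t s a) (fun _ _ => Nat.zero_le _)
        (Finset.mem_range.2 (hπ s (Finset.mem_range.1 hs)))

theorem WP.roundGains (hB : b ≤ B) (hL : d.Fits b L) (hσ : Bounded B σ) (hd : Ready d σ) :
    WP B L roundGains (fun τ => ∀ e < d.E, τ rRound e =
      min (σ rGain e) (σ rGain (σ rItem 0)) * (d.K * d.n₁) / σ rGain (σ rItem 0)) σ := by
  unfold RAM.roundGains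
  set M := σ rGain (σ rItem 0) with hM
  refine WP.set_seq hσ (by simpa using hσ _ _) fun hσ₁ => ?_
  simp only [Expr.eval_lit, Expr.eval_get, ← hM] at hσ₁ ⊢
  set σ₁ := write σ rMax 0 M with hσ₁E
  have fr : ∀ a, a ≠ rMax → σ₁ a = σ a := fun a h₁ => by
    funext j; simp [hσ₁E, write, h₁]
  have hd₁ : Ready d σ₁ := hd.congr fun a ha _ => fr a (by omega)
  refine WP.for (N := d.E) (fun k τ => ∀ e < k, τ rRound e =
    min (σ rGain e) M * (d.K * d.n₁) / M) hσ₁ (by decide) (by decide)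
    (by decide) hd₁.E hL.E_le (by simp) ?_
  intro k τ hk hτ hi hf hinv
  have hdτ : Ready d τ := hd₁.congr fun a ha h1 => hf a (by omega) (by revert a; decide)
  have hmax : τ rMax 0 = M := by rw [hf _ (by decide) (by decide)]; simp [hσ₁E, write]
  have hgain : τ rGain = σ rGain := by rw [hf _ (by decide) (by decide), fr _ (by decide)]
  have hmin : ∀ x y : ℕ, x - (x - y) = min x y := by omega
  refine WP.set hτ ?_ ?_
  · simp only [Expr.eval_div, Expr.eval_mul, Expr.eval_sub, Expr.eval_get, Expr.eval_lit, hmin, hmax,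
      hi, hdτ.KN, hgain]
    refine lt_of_le_of_lt ?_ (hL.KN_lt.trans_le (Nat.pow_le_pow_right (by norm_num) hB))
    -- For `M = 0` division by zero gives `0`; otherwise clipping at `M` bounds the quotient by `K
    -- n₁`.
    rcases Nat.eq_zero_or_pos M with h | h
    · simp [h]
    · rw [Nat.div_le_iff_le_mul_add_pred h]
      have := Nat.mul_le_mul_right (d.K * d.n₁) (min_le_right (σ rGain k) M)
      omega
  · intro e he
    rcases Nat.lt_succ_iff_lt_or_eq.1 he with h | rfl
    · have hne : e ≠ k := by omega
      simpa [write, hi, hne] using hinv e h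
    · simp [write, hi, hmin, hmax, hdτ.KN, hgain]

end RAM

/-! ### The dynamic program -/

/-- The pair `(v, c)` is a maximal value of `V (x - g a) + r a` for `a < m`, with a maximizer. -/
def IsBest (m : ℕ) (g r V : ℕ → ℕ) (x v c : ℕ) : Prop :=
  c < m ∧ v = V (x - g c) + r c ∧ ∀ a < m, V (x - g a) + r a ≤ v

/-- The table of the dynamic program that maximizes the sum of `r s (π s)` and a bonus `big` for the
sum of `g s (π s)` being at least `x`. -/
structure IsTable (n T : ℕ) (m : ℕ → ℕ) (g r : ℕ → ℕ → ℕ) (big : ℕ) (V C : ℕ → ℕ → ℕ) : Prop where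
  base : ∀ x < T, V 0 x = if x = 0 then big else 0
  step : ∀ k < n, ∀ x < T, IsBest (m k) (g k) (r k) (V k) x (V (k + 1) x) (C k x)

namespace IsTable

variable {n T : ℕ} {m : ℕ → ℕ} {g r : ℕ → ℕ → ℕ} {big : ℕ} {V C : ℕ → ℕ → ℕ}

/-- The table dominates every policy, as each row maximizes over all actions, in particular over `π
k`. -/
theorem sum_le (h : IsTable n T m g r big V C) {π : ℕ → ℕ} (hπ : ∀ s < n, π s < m s) :
    ∀ k ≤ n, ∀ x < T, ∑ s ∈ Finset.range k, r s (π s) +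
      (if x ≤ ∑ s ∈ Finset.range k, g s (π s) then big else 0) ≤ V k x := by
  intro k
  induction k with
  | zero => intro _ x hx; simp [h.base x hx]
  | succ k ih =>
    intro hk x hx
    have h₁ := (h.step k hk x hx).2.2 (π k) (hπ k hk)
    have h₂ := ih (by omega) (x - g k (π k)) (by omega)
    rw [Finset.sum_range_succ, Finset.sum_range_succ]
    -- Truncated subtraction is exactly right for a target of the form "at least `x`".
    have : (x - g k (π k) ≤ ∑ s ∈ Finset.range k, g s (π s)) ↔
        x ≤ ∑ s ∈ Finset.range k, g s (π s) + g k (π k) := by omega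
    simp only [this] at h₂
    omega

/-- `π` is the policy that is read off the table, from the entry `y n` backwards. -/
def Traces (n : ℕ) (g C : ℕ → ℕ → ℕ) (y π : ℕ → ℕ) : Prop :=
  ∀ s < n, π s = C s (y (s + 1)) ∧ y s = y (s + 1) - g s (π s)

/-- Targets only decrease towards state `0`; the index counts from the end because only `y n` is
known to be small. -/
theorem Traces.lt {y π : ℕ → ℕ} (hy : Traces n g C y π) (hT : y n < T) :
    ∀ j ≤ n, y (n - j) < T := by
  intro j
  induction j with
  | zero => simpa using hT
  | succ j ih =>
    intro hj
    have h₁ := (hy (n - (j + 1)) (by omega)).2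
    have : n - (j + 1) + 1 = n - j := by omega
    rw [this] at h₁
    have := ih (by omega)
    omega

theorem isPolicy_of_traces (h : IsTable n T m g r big V C) {y π : ℕ → ℕ} (hy : Traces n g C y π)
    (hT : y n < T) : ∀ s < n, π s < m s := by
  intro s hs
  have := hy.lt hT (n - (s + 1)) (by omega)
  rw [show n - (n - (s + 1)) = s + 1 by omega] at this
  rw [(hy s hs).1]
  exact (h.step s hs _ this).1

/-- Along the trace each inequality of `sum_le` is attained, because the stored actions are
maximizers. -/
theorem eq_sum (h : IsTable n T m g r big V C) {y π : ℕ → ℕ} (hy : Traces n g C y π)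
    (hT : y n < T) : ∀ k ≤ n, V k (y k) = ∑ s ∈ Finset.range k, r s (π s) +
      if y k ≤ ∑ s ∈ Finset.range k, g s (π s) then big else 0 := by
  have hlt : ∀ k ≤ n, y k < T := fun k hk => by
    have := hy.lt hT (n - k) (by omega)
    rwa [show n - (n - k) = k by omega] at this
  intro k
  induction k with
  | zero => intro _; simp [h.base _ (hlt 0 (Nat.zero_le _))]
  | succ k ih =>
    intro hk
    have h₁ := (h.step k hk _ (hlt (k + 1) hk)).2.1
    obtain ⟨h₂, h₃⟩ := hy k hk
    rw [← h₂, ← h₃, ih (by omega)] at h₁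
    have : (y k ≤ ∑ s ∈ Finset.range k, g s (π s)) ↔
        y (k + 1) ≤ ∑ s ∈ Finset.range k, g s (π s) + g k (π k) := by omega
    rw [h₁, Finset.sum_range_succ, Finset.sum_range_succ]
    simp only [this]
    omega

/-- The policy that is read off the table at the sum of gains of some policy has at least the gains and
the rests of that policy. -/
theorem optimal (h : IsTable n T m g r big V C)
    (hbig : ∀ π : ℕ → ℕ, (∀ s < n, π s < m s) → ∑ s ∈ Finset.range n, r s (π s) < big)
    {y ρ : ℕ → ℕ} (hy : Traces n g C y ρ) (hT : y n < T) {π : ℕ → ℕ} (hπ : ∀ s < n, π s < m s)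
    (hx : y n = ∑ s ∈ Finset.range n, g s (π s)) :
    ∑ s ∈ Finset.range n, g s (π s) ≤ ∑ s ∈ Finset.range n, g s (ρ s) ∧
      ∑ s ∈ Finset.range n, r s (π s) ≤ ∑ s ∈ Finset.range n, r s (ρ s) := by
  have h₁ := h.sum_le hπ n le_rfl (y n) hT
  have h₂ := h.eq_sum hy hT n le_rfl
  have h₃ := hbig ρ (h.isPolicy_of_traces hy hT)
  -- `π` meets the target, so the entry is at least `big`. Without the bonus, `ρ` would reach less
  -- than `big`; hence `ρ` meets the target too, and cancelling the bonus compares the rests.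
  rw [if_pos hx.le] at h₁
  split_ifs at h₂ with h₄ <;> omega

end IsTable

/-- Rounding the gains of a policy and of a comparison policy costs a fraction `1 / K` of the total gain
of the comparison policy. -/
theorem sub_one_mul_sum_le_of_rounded {n K M : ℕ} {f f' : ℕ → ℕ} {i : ℕ} (hi : i < n) (hM : f i = M)
    (hf : ∀ s < n, f s ≤ M)
    (h : ∑ s ∈ Finset.range n, min (f s) M * (K * n) / M ≤
      ∑ s ∈ Finset.range n, min (f' s) M * (K * n) / M) :
    (K - 1) * ∑ s ∈ Finset.range n, f s ≤ K * ∑ s ∈ Finset.range n, f' s := by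
  rcases Nat.eq_zero_or_pos M with rfl | hpos
  · have : ∑ s ∈ Finset.range n, f s = 0 :=
      Finset.sum_eq_zero fun s hs => Nat.le_zero.1 (hf s (Finset.mem_range.1 hs))
    simp [this]
  have hn : 0 < n := by omega
  have hMle : M ≤ ∑ s ∈ Finset.range n, f s := by
    rw [← hM]
    exact Finset.single_le_sum (f := f) (fun _ _ => Nat.zero_le _) (Finset.mem_range.2 hi)
  -- Rounding down and clipping never overestimate the gains of `f'`.
  have h₁ : M * ∑ s ∈ Finset.range n, min (f' s) M * (K * n) / M ≤
      (∑ s ∈ Finset.range n, f' s) * (K * n) := by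
    rw [Finset.mul_sum, Finset.sum_mul]
    exact Finset.sum_le_sum fun s _ =>
      (Nat.mul_div_le _ _).trans (Nat.mul_le_mul_right _ (min_le_left _ _))
  -- Each of the `n` terms loses at most `M` by the floor; clipping does not affect `f`.
  have h₂ : (∑ s ∈ Finset.range n, f s) * (K * n) ≤
      M * ∑ s ∈ Finset.range n, min (f s) M * (K * n) / M + M * n := by
    have : M * n = ∑ s ∈ Finset.range n, M := by simp [mul_comm]
    rw [this, Finset.mul_sum, Finset.sum_mul, ← Finset.sum_add_distrib]
    refine Finset.sum_le_sum fun s hs => ?_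
    rw [min_eq_left (hf s (Finset.mem_range.1 hs))]
    have := Nat.lt_mul_div_succ (f s * (K * n)) hpos
    rw [mul_add, mul_one] at this
    exact this.le
  have h₃ := Nat.mul_le_mul_left M h
  have h₄ : n * (K * ∑ s ∈ Finset.range n, f s) ≤
      n * (K * ∑ s ∈ Finset.range n, f' s + M) := by
    calc n * (K * ∑ s ∈ Finset.range n, f s) = (∑ s ∈ Finset.range n, f s) * (K * n) := by ring
      _ ≤ (∑ s ∈ Finset.range n, f' s) * (K * n) + M * n := by omega
      _ = _ := by ring
  have h₅ := Nat.le_of_mul_le_mul_left h₄ hn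
  -- Now `K * ∑ f ≤ K * ∑ f' + M`, and `M ≤ ∑ f` since `M` is one of the terms.
  rw [Nat.sub_one_mul]
  omega

/-! ### Correctness of the subroutines: dynamic program, reconstruction, evaluation, selection -/

namespace RAM

open ScaledInstance

variable {d : ScaledInstance} {σ τ : Memory} {b B L : ℕ}

theorem WP.dpCell (hB : b ≤ B) (hL : d.Fits b L) (hσ : Bounded B σ) (hd : Ready d σ)
    {s x : ℕ} (hs : s < d.n₁) (hm : 0 < d.m s) (hx : x < d.T) (hS : σ rS 0 = s) (hH : σ rH 0 = x)
    (hMs : σ rMs 0 = d.m s) (hcell : s * d.T + x < 2 ^ B)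
    (hval : ∀ y < d.T, ∀ a < d.m s,
      σ rVal (s * d.T + y) + σ rRest (d.off s + a) < 2 ^ B) :
    WP B L dpCell (fun τ =>
      (∀ j, j ≠ s * d.T + x + d.T → τ rVal j = σ rVal j) ∧
      (∀ j, j ≠ s * d.T + x → τ rArg j = σ rArg j) ∧
      IsBest (d.m s) (fun a => σ rRound (d.off s + a)) (fun a => σ rRest (d.off s + a))
        (fun y => σ rVal (s * d.T + y)) x (τ rVal (s * d.T + x + d.T)) (τ rArg (s * d.T + x))) σ := by
  have hT := hd.T
  unfold RAM.dpCell
  refine WP.set_seq hσ (by simpa [hS, hH, hT] using hcell) fun hσ₁ => ?_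
  refine WP.set_seq hσ₁ (by simp) fun hσ₂ => ?_
  refine WP.set_seq hσ₂ (by simp) fun hσ₃ => ?_
  generalize hσ₃E : write (write (write σ _ _ _) _ _ _) _ _ _ = σ₃ at hσ₃ ⊢
  have fr : ∀ a, a ≠ rCell → a ≠ rVal → a ≠ rArg → σ₃ a = σ a := fun a h₁ h₂ h₃ => by
    subst hσ₃E; funext j; simp [write, h₁, h₂, h₃]
  have hcell₃ : σ₃ rCell 0 = s * d.T + x := by subst hσ₃E; simp [write, hS, hH, hT]
  have hval₃ : ∀ j, j ≠ s * d.T + x + d.T → σ₃ rVal j = σ rVal j := fun j hj => by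
    subst hσ₃E; simp [write, hS, hH, hT, hj]
  have hval₃' : σ₃ rVal (s * d.T + x + d.T) = 0 := by subst hσ₃E; simp [write, hS, hH, hT]
  have harg₃ : ∀ j, j ≠ s * d.T + x → σ₃ rArg j = σ rArg j := fun j hj => by
    subst hσ₃E; simp [write, hS, hH, hT, hj]
  have harg₃' : σ₃ rArg (s * d.T + x) = 0 := by subst hσ₃E; simp [write, hS, hH, hT]
  clear hσ₃E
  let cand : ℕ → ℕ := fun a =>
    σ rVal (s * d.T + (x - σ rRound (d.off s + a))) + σ rRest (d.off s + a)
  -- The last two clauses separate the initial entry, which need not be the value of a candidate,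
  -- from the entries after action `0` has been treated.
  refine (WP.for (N := d.m s) (fun a τ =>
    (∀ j, j ≠ s * d.T + x + d.T → τ rVal j = σ rVal j) ∧
    (∀ j, j ≠ s * d.T + x → τ rArg j = σ rArg j) ∧
    (∀ a' < a, cand a' ≤ τ rVal (s * d.T + x + d.T)) ∧
    (a = 0 → τ rVal (s * d.T + x + d.T) = 0 ∧ τ rArg (s * d.T + x) = 0) ∧
    (0 < a → τ rArg (s * d.T + x) < a ∧
      τ rVal (s * d.T + x + d.T) = cand (τ rArg (s * d.T + x)))) hσ₃ (by decide) (by decide)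
    (by decide) (by rw [fr _ (by decide) (by decide) (by decide), hMs])
    ((m_le_E hs).trans hL.E_le) ?_ ?_).mono ?_
  · refine ⟨?_, ?_, ?_, ?_, ?_⟩
    · simpa [write] using hval₃
    · simpa [write] using harg₃
    · simp
    · simp [write, hval₃', harg₃']
    · simp
  · rintro a τ ha hτ hA hf ⟨h₁, h₂, h₃, h₄, h₅⟩
    have hfr : ∀ j, j ≠ rA → j ≠ rIdx → j ≠ rCand → j ≠ rCell → j ≠ rVal → j ≠ rArg →
        τ j = σ j := fun j g₁ g₂ g₃ g₄ g₅ g₆ => by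
      rw [hf j g₁ (by simp [Prog.writes, *]), fr j g₄ g₅ g₆]
    have hdτ : Ready d τ := hd.congr fun j hj _ =>
      hfr j (by omega) (by omega) (by omega) (by omega) (by omega) (by omega)
    have hSτ : τ rS 0 = s := by rw [hfr] <;> first | exact hS | decide
    have hHτ : τ rH 0 = x := by rw [hfr] <;> first | exact hH | decide
    have hround : τ rRound = σ rRound := by apply hfr <;> decide
    have hrest : τ rRest = σ rRest := by apply hfr <;> decide
    have hcellτ : τ rCell 0 = s * d.T + x := by rw [hf _ (by decide) (by decide), hcell₃]
    -- Candidates are read from row `s`, while the loop changes only an entry of row `s + 1`.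
    have hcandval : τ rVal (s * d.T + (x - σ rRound (d.off s + a))) =
        σ rVal (s * d.T + (x - σ rRound (d.off s + a))) := h₁ _ (by omega)
    have hcandlt : cand a < 2 ^ B := hval _ (by omega) a ha
    have hidx : d.off s + a < 2 ^ B := (off_add_lt hs ha).trans
      (hL.E_lt.trans_le (Nat.pow_le_pow_right (by norm_num) hB))
    have hoff := hdτ.off s hs.le
    have hTτ := hdτ.T
    refine WP.set_seq hτ (by simpa [hSτ, hA, hoff] using hidx) fun hτ₁ => ?_
    have hcE : (Expr.get rVal (.var rS * .var rT + (.var rH - .get rRound (.var rIdx))) +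
        .get rRest (.var rIdx)).eval (write τ rIdx ((Expr.lit 0).eval τ)
          ((Expr.get rOff (.var rS) + .var rA).eval τ)) = cand a := by
      simp [write, hSτ, hA, hHτ, hoff, hTτ, hround, hrest, hcandval, cand]
    refine WP.set_seq hτ₁ (by rwa [hcE]) fun hτ₂ => ?_
    rw [hcE] at hτ₂ ⊢
    refine WP.ite hτ₂ (fun hne => ?_) (fun he => ?_)
    · have hlt : τ rVal (s * d.T + x + d.T) < cand a := by
        simp [write, hcellτ, hTτ] at hne
        omega
      refine WP.set_seq hτ₂ (by simpa [write] using hcandlt) fun hτ₃ => ?_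
      refine WP.set hτ₃ (by simpa [write, hA] using (hA ▸ hτ rA 0 : a < 2 ^ B)) ?_
      simp only [write, Expr.eval_get, Expr.eval_lit, Expr.eval_add]
      refine ⟨?_, ?_, ?_, ?_, ?_⟩
      · simp +contextual [hcellτ, hTτ, h₁]
      · simp +contextual [hcellτ, h₂]
      · intro a' ha'
        rcases Nat.lt_succ_iff_lt_or_eq.1 ha' with h | rfl
        · simpa [hcellτ, hTτ] using (h₃ a' h).trans hlt.le
        · simp [hcellτ, hTτ]
      · simp
      · simp [hcellτ, hTτ, hA]
    · have hle : cand a ≤ τ rVal (s * d.T + x + d.T) := by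
        simp [write, hcellτ, hTτ] at he
        omega
      refine WP.skip hτ₂ ?_
      simp only [write, Expr.eval_get, Expr.eval_lit, Expr.eval_add]
      refine ⟨?_, ?_, ?_, ?_, ?_⟩
      · simpa using h₁
      · simpa using h₂
      · intro a' ha'
        rcases Nat.lt_succ_iff_lt_or_eq.1 ha' with h | rfl
        · simpa using h₃ a' h
        · simpa using hle
      · simp
      -- If action `0` fails the strict test against the initial value `0`, then its candidate value
      -- is `0`, and the initial argument `0` is already correct.
      · rcases Nat.eq_zero_or_pos a with rfl | hpos
        · obtain ⟨h₆, h₇⟩ := h₄ rfl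
          have : cand 0 = 0 := by omega
          simp [h₆, h₇, this]
        · obtain ⟨h₆, h₇⟩ := h₅ hpos
          simpa [h₇] using Nat.lt_succ_of_lt h₆
  · rintro ω _ _ ⟨h₁, h₂, h₃, _, h₅⟩
    exact ⟨h₁, h₂, (h₅ hm).1, (h₅ hm).2, h₃⟩

end RAM

namespace RAM

open ScaledInstance

variable {d : ScaledInstance} {σ τ : Memory} {b B L : ℕ}

theorem WP.dp (hB : 5 * b + 2 ≤ B) (hL : d.Fits b L) (hσ : Bounded B σ) (hd : Ready d σ)
    (hm : ∀ s < d.n₁, 0 < d.m s)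
    (hrest : ∀ s < d.n₁, ∀ a < d.m s, σ rRest (d.off s + a) ≤ 2 ^ (4 * b))
    (hbig : σ rBig 0 ≤ 1 + d.E * 2 ^ (4 * b)) :
    WP B L dp (fun τ => IsTable d.n₁ d.T d.m (fun s a => σ rRound (d.off s + a))
      (fun s a => σ rRest (d.off s + a)) (σ rBig 0) (fun s x => τ rVal (s * d.T + x))
      (fun s x => τ rArg (s * d.T + x))) σ := by
  have hbound : σ rBig 0 + d.n₁ * 2 ^ (4 * b) + 2 ^ (4 * b) < 2 ^ B := by
    have h₁ : 2 ^ (5 * b + 2) ≤ 2 ^ B := Nat.pow_le_pow_right (by norm_num) hB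
    have h₂ : 2 ^ (5 * b + 2) = 4 * (2 ^ b * 2 ^ (4 * b)) := by ring
    have h₃ : (d.E + 1) * 2 ^ (4 * b) ≤ 2 ^ b * 2 ^ (4 * b) := Nat.mul_le_mul_right _ hL.E_lt
    have h₄ : (d.n₁ + 1) * 2 ^ (4 * b) ≤ 2 ^ b * 2 ^ (4 * b) := Nat.mul_le_mul_right _ hL.n₁_lt
    have h₅ : 0 < 2 ^ (4 * b) := by positivity
    nlinarith
  have hindex : d.n₁ * d.T < 2 ^ B :=
    calc d.n₁ * d.T < 2 ^ b * 2 ^ b := Nat.mul_lt_mul'' hL.n₁_lt hL.T_lt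
      _ = 2 ^ (2 * b) := by ring
      _ ≤ 2 ^ B := Nat.pow_le_pow_right (by norm_num) (by omega)
  unfold RAM.dp
  refine WP.seq (WP.for (N := d.T) (fun x τ => ∀ y < x, τ rVal y = 0) hσ (by decide) (by decide)
    (by decide) hd.T hL.T_le (by simp) ?_) fun σ₁ hσ₁ hf₁ hz => ?_
  · intro x τ hx hτ hi hf hinv
    refine WP.set hτ (by simp) ?_
    intro y hy
    rcases Nat.lt_succ_iff_lt_or_eq.1 hy with h | rfl
    · have := hinv y h
      simp [write, this]
    · simp [write, hi]
  have hbig₁ : σ₁ rBig 0 = σ rBig 0 := by rw [hf₁ _ (by decide)]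
  refine WP.set_seq hσ₁ (by simpa using hσ₁ _ _) fun hσ₂ => ?_
  generalize hσ₂E : write σ₁ _ _ _ = σ₂ at hσ₂ ⊢
  have fr₂ : ∀ a, a ≠ rI → a ≠ rVal → σ₂ a = σ a := fun a h₁ h₂ => by
    rw [← hf₁ a (by simp [Prog.for, Prog.writes, *])]
    subst hσ₂E
    funext j
    simp [write, h₂]
  have hbase : ∀ x < d.T, σ₂ rVal x = if x = 0 then σ rBig 0 else 0 := fun x hx => by
    subst hσ₂E
    simp [write, hbig₁, hz x hx]
  clear hσ₂E
  have hd₂ : Ready d σ₂ := hd.congr fun a ha _ => fr₂ a (by omega) (by omega)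
  -- The second conjunct limits the growth to one rest per row, so that all entries fit into
  -- registers of `B` bits.
  refine (WP.for (N := d.n₁) (fun k τ => IsTable k d.T d.m (fun s a => σ rRound (d.off s + a))
      (fun s a => σ rRest (d.off s + a)) (σ rBig 0) (fun s x => τ rVal (s * d.T + x))
      (fun s x => τ rArg (s * d.T + x)) ∧
      ∀ x < d.T, τ rVal (k * d.T + x) ≤ σ rBig 0 + k * 2 ^ (4 * b)) hσ₂ (by decide) (by decide)
    (by decide) hd₂.n₁ hL.n₁_le ?_ ?_).mono fun _ _ _ h => h.1
  · refine ⟨⟨?_, by simp⟩, ?_⟩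
    · simpa [write] using hbase
    · intro x hx
      have := hbase x hx
      simp only [write, zero_mul, zero_add]
      simp only [Nat.reduceEqDiff, false_and, if_false, this]
      split_ifs <;> omega
  rintro k τ hk hτ hS hf ⟨htab, hle⟩
  have hfr : ∀ a < 37, a ≠ 1 → (a < 26 ∨ 31 < a ∧ a < 37) → τ a = σ a := fun a h₁ h₂ h₃ => by
    rw [hf a (by omega) (by revert a; decide), fr₂ a (by omega) (by omega)]
  have hdτ : Ready d τ := hd.congr fun a ha h1 => hfr a (by omega) h1 (by omega)
  refine WP.set_seq hτ (by simpa [hS] using hτ _ _) fun hτ₁ => ?_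
  simp only [Expr.eval_get, Expr.eval_lit, Expr.eval_add, Expr.eval_ofNat, hS, hdτ.m] at hτ₁ ⊢
  generalize hτ₁E : write τ rMs 0 (d.m k) = τ₁ at hτ₁ ⊢
  have fr₁ : ∀ a, a ≠ rMs → τ₁ a = τ a := fun a h₁ => by
    subst hτ₁E; funext j; simp [write, h₁]
  have hMs : τ₁ rMs 0 = d.m k := by subst hτ₁E; simp [write]
  clear hτ₁E
  have hd₁ : Ready d τ₁ := hdτ.congr fun a ha _ => fr₁ a (by omega)
  refine (WP.for (N := d.T) (fun x ρ =>
    (∀ j < k * d.T + d.T, ρ rVal j = τ rVal j) ∧ (∀ j < k * d.T, ρ rArg j = τ rArg j) ∧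
    ∀ y < x, IsBest (d.m k) (fun a => σ rRound (d.off k + a)) (fun a => σ rRest (d.off k + a))
      (fun y => τ rVal (k * d.T + y)) y (ρ rVal (k * d.T + y + d.T)) (ρ rArg (k * d.T + y)))
    hτ₁ (by decide) (by decide) (by decide) hd₁.T hL.T_le ?_ ?_).mono ?_
  · simp [write, fr₁ rVal (by decide), fr₁ rArg (by decide)]
  · rintro x ρ hx hρ hH hfρ ⟨h₁, h₂, h₃⟩
    have hfrρ : ∀ a, a ≠ rH → a ∉ RAM.dpCell.writes → a ≠ rMs → ρ a = τ a := fun a g₁ g₂ g₃ => by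
      rw [hfρ a g₁ g₂, fr₁ a g₃]
    have hdρ : Ready d ρ := hd₁.congr fun a ha h1 => hfρ a (by omega) (by revert a; decide)
    have hround : ρ rRound = σ rRound := by
      rw [hfrρ _ (by decide) (by decide) (by decide)]
      apply hfr <;> decide
    have hrestE : ρ rRest = σ rRest := by
      rw [hfrρ _ (by decide) (by decide) (by decide)]
      apply hfr <;> decide
    have hSρ : ρ rS 0 = k := by rw [hfrρ _ (by decide) (by decide) (by decide), hS]
    have hMρ : ρ rMs 0 = d.m k := by rw [hfρ _ (by decide) (by decide), hMs]
    have hkn : k * d.T + d.T ≤ d.n₁ * d.T := by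
      rw [← Nat.succ_mul]; exact Nat.mul_le_mul_right _ hk
    refine (WP.dpCell (by omega) hL hρ hdρ hk (hm k hk) hx hSρ hH hMρ (by omega) ?_).mono ?_
    · intro y hy a ha
      rw [hrestE, h₁ _ (by omega)]
      have g₁ := hle y hy
      have g₂ := hrest k hk a ha
      have g₃ : k * 2 ^ (4 * b) ≤ d.n₁ * 2 ^ (4 * b) := Nat.mul_le_mul_right _ hk.le
      omega
    · rintro ω hω hfω ⟨g₁, g₂, g₃⟩
      refine ⟨?_, ?_, ?_⟩
      · intro j hj
        simpa [write, g₁ j (by omega)] using h₁ j hj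
      · intro j hj
        simpa [write, g₂ j (by omega)] using h₂ j hj
      · intro y hy
        rcases Nat.lt_succ_iff_lt_or_eq.1 hy with h | rfl
        · simpa [write, g₁ (k * d.T + y + d.T) (by omega), g₂ (k * d.T + y) (by omega)] using h₃ y h
        · obtain ⟨e₁, e₂, e₃⟩ := g₃
          simp only [hround, hrestE] at e₁ e₂ e₃
          rw [h₁ _ (by omega)] at e₂
          simp only [write]
          refine ⟨e₁, e₂, fun a ha => ?_⟩
          have := e₃ a ha
          rwa [h₁ _ (by omega)] at this
  · rintro ω hω hfω ⟨g₁, g₂, g₃⟩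
    -- The inner loop leaves the value rows up to `k` and the choice rows below `k` untouched.
    have hrow : ∀ i ≤ k, ∀ x < d.T, ω rVal (i * d.T + x) = τ rVal (i * d.T + x) := fun i hi x hx =>
      g₁ _ (by have := Nat.mul_le_mul_right d.T hi; omega)
    have hrow' : ∀ i < k, ∀ x < d.T, ω rArg (i * d.T + x) = τ rArg (i * d.T + x) := fun i hi x hx =>
      g₂ _ (by have := Nat.mul_le_mul_right d.T (Nat.succ_le_of_lt hi); rw [Nat.succ_mul] at this; omega)
    have hsucc : ∀ x, (k + 1) * d.T + x = k * d.T + x + d.T := fun x => by ring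
    have hw : ∀ j, write ω rS 0 (k + 1) rVal j = ω rVal j := fun j => by simp [write]
    have hw' : ∀ j, write ω rS 0 (k + 1) rArg j = ω rArg j := fun j => by simp [write]
    simp only [hw, hw']
    refine ⟨⟨?_, ?_⟩, ?_⟩
    · intro x hx
      have h₁ := hrow 0 (Nat.zero_le _) x hx
      have h₂ := htab.base x hx
      simp only [h₁, h₂]
    · intro i hi x hx
      rcases Nat.lt_succ_iff_lt_or_eq.1 hi with h | rfl
      · obtain ⟨e₁, e₂, e₃⟩ := htab.step i h x hx
        refine ⟨?_, ?_, ?_⟩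
        · simpa only [hrow' i h x hx] using e₁
        · beta_reduce
          rw [hrow (i + 1) h x hx, hrow' i h x hx, hrow i h.le _ (by omega)]
          exact e₂
        · intro a ha
          beta_reduce
          rw [hrow (i + 1) h x hx, hrow i h.le _ (by omega)]
          exact e₃ a ha
      · obtain ⟨e₁, e₂, e₃⟩ := g₃ x hx
        refine ⟨e₁, ?_, ?_⟩
        · beta_reduce
          rw [hsucc, e₂, hrow i le_rfl _ (by omega)]
        · intro a ha
          beta_reduce
          rw [hsucc, hrow i le_rfl _ (by omega)]
          exact e₃ a ha
    · intro x hx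
      obtain ⟨e₁, e₂, -⟩ := g₃ x hx
      rw [hsucc, e₂]
      have h₁ := hle (x - σ rRound (d.off k + ω rArg (k * d.T + x))) (by omega)
      have h₂ := hrest k hk _ e₁
      beta_reduce
      rw [Nat.succ_mul]
      omega

theorem WP.reconstruct (hL : d.Fits b L) (hσ : Bounded B σ) (hd : Ready d σ) :
    WP B L reconstruct (fun τ => τ rY d.n₁ = σ rX 0 ∧
      IsTable.Traces d.n₁ (fun s a => σ rRound (d.off s + a)) (fun s x => σ rArg (s * d.T + x))
        (τ rY) (τ rPol)) σ := by
  have hn₁ := hd.n₁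
  unfold RAM.reconstruct
  refine WP.set_seq hσ (by simpa using hσ _ _) fun hσ₁ => ?_
  simp only [Expr.eval_get, Expr.eval_lit, hn₁] at hσ₁ ⊢
  generalize hσ₁E : write σ _ _ _ = σ₁ at hσ₁ ⊢
  have fr : ∀ a, a ≠ rY → σ₁ a = σ a := fun a h₁ => by
    subst hσ₁E; funext j; simp [write, h₁]
  have hY : σ₁ rY d.n₁ = σ rX 0 := by subst hσ₁E; simp [write]
  clear hσ₁E
  have hd₁ : Ready d σ₁ := hd.congr fun a ha _ => fr a (by omega)
  -- The trace is built backwards: after `j` rounds the last `j` states are done.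
  refine (WP.for (N := d.n₁) (fun j τ => τ rY d.n₁ = σ rX 0 ∧ ∀ s < d.n₁, d.n₁ ≤ s + j →
    τ rPol s = σ rArg (s * d.T + τ rY (s + 1)) ∧
    τ rY s = τ rY (s + 1) - σ rRound (d.off s + τ rPol s)) hσ₁ (by decide) (by decide)
    (by decide) hd₁.n₁ hL.n₁_le ?_ ?_).mono ?_
  · refine ⟨by simpa [write] using hY, ?_⟩
    intro s h₁ h₂
    omega
  · rintro j τ hj hτ hi hf ⟨h₁, h₂⟩
    have hdτ : Ready d τ := hd₁.congr fun a ha h1 => hf a (by omega) (by revert a; decide)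
    have harg : τ rArg = σ rArg := by rw [hf _ (by decide) (by decide), fr _ (by decide)]
    have hround : τ rRound = σ rRound := by rw [hf _ (by decide) (by decide), fr _ (by decide)]
    have hn₁τ := hdτ.n₁
    have hTτ := hdτ.T
    obtain ⟨s, hs⟩ : ∃ s, s = d.n₁ - 1 - j := ⟨_, rfl⟩
    have hoff := hdτ.off s (by omega)
    refine WP.set_seq hτ ?_ fun hτ₁ => ?_
    · have := hτ rN₁ 0
      simp only [Expr.eval_sub, Expr.eval_get, Expr.eval_lit, Expr.eval_ofNat]
      omega
    have hsE : (Expr.var rN₁ - 1 - .var rI).eval τ = s := by simp [hi, hn₁τ, hs]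
    rw [hsE] at hτ₁ ⊢
    refine WP.set_seq hτ₁ (by simpa using hτ₁ _ _) fun hτ₂ => ?_
    refine WP.set hτ₂ (by simpa using (Nat.sub_le _ _).trans_lt (hτ₂ _ _)) ?_
    simp only [write, Expr.eval_get, Expr.eval_lit, Expr.eval_add, Expr.eval_sub, Expr.eval_mul,
      Expr.eval_ofNat]
    refine ⟨?_, ?_⟩
    · have : d.n₁ ≠ s := by omega
      simpa [this] using h₁
    · intro s' hs' hle
      rcases eq_or_ne s' s with rfl | hne
      · simp [hTτ, harg, hoff, hround]
      · have h₃ : s' + 1 ≠ s := by omega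
        have := h₂ s' hs' (by omega)
        simpa [hne, h₃] using this
  · rintro ω hω hfω ⟨h₁, h₂⟩
    exact ⟨h₁, fun s hs => h₂ s hs (by omega)⟩

theorem WP.evaluate (hB : 5 * b ≤ B) (hL : d.Fits b L) (hσ : Bounded B σ) (hd : Ready d σ) {a₀ t : ℕ}
    (htab : ∀ s < d.n₁, σ rGain (d.off s + σ rPol s) = d.gain a₀ t s (σ rPol s) ∧
        σ rRest (d.off s + σ rPol s) = d.rest a₀ t s (σ rPol s)) (hπ : d.IsPolicy (σ rPol)) :
    WP B L evaluate (fun τ => τ rScore 0 = d.score a₀ t (σ rPol)) σ := by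
  have hlt : ∀ (f : ℕ → ℕ), (∀ s, f s ≤ 2 ^ (4 * b)) → ∀ k ≤ d.n₁,
      ∑ s ∈ Finset.range k, f s < 2 ^ B := fun f hf k hk => by
    have h₁ : ∑ s ∈ Finset.range k, f s ≤ k * 2 ^ (4 * b) := by
      simpa using Finset.sum_le_card_nsmul (Finset.range k) f _ fun s _ => hf s
    have h₂ : k * 2 ^ (4 * b) < 2 ^ b * 2 ^ (4 * b) :=
      Nat.mul_lt_mul_of_pos_right (hk.trans_lt hL.n₁_lt) (by positivity)
    have h₃ : 2 ^ b * 2 ^ (4 * b) = 2 ^ (5 * b) := by ring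
    have h₄ : 2 ^ (5 * b) ≤ 2 ^ B := Nat.pow_le_pow_right (by norm_num) hB
    omega
  have hG := hlt (fun s => d.gain a₀ t s (σ rPol s)) fun s => (hL.gain_lt _ _ _ _).le.trans
    (Nat.pow_le_pow_right (by norm_num) (by omega))
  have hR := hlt (fun s => d.rest a₀ t s (σ rPol s)) fun s => (hL.rest_lt _ _ _ _).le
  have hmin : ∀ x y : ℕ, x - (x - y) = min x y := by omega
  unfold RAM.evaluate
  refine WP.set_seq hσ (by simp) fun hσ₁ => ?_
  refine WP.set_seq hσ₁ (by simp) fun hσ₂ => ?_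
  simp only [Expr.eval_lit, Expr.eval_ofNat] at hσ₂ ⊢
  generalize hσ₂E : write (write σ _ _ _) _ _ _ = σ₂ at hσ₂ ⊢
  have fr : ∀ a, a ≠ rSumG → a ≠ rSumR → σ₂ a = σ a := fun a h₁ h₂ => by
    subst hσ₂E; funext j; simp [write, h₁, h₂]
  have h₀ : σ₂ rSumG 0 = 0 ∧ σ₂ rSumR 0 = 0 := by subst hσ₂E; simp [write]
  clear hσ₂E
  have hd₂ : Ready d σ₂ := hd.congr fun a ha _ => fr a (by omega) (by omega)
  refine WP.seq (WP.for (N := d.n₁) (fun k τ =>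
    τ rSumG 0 = ∑ s ∈ Finset.range k, d.gain a₀ t s (σ rPol s) ∧
    τ rSumR 0 = ∑ s ∈ Finset.range k, d.rest a₀ t s (σ rPol s)) hσ₂ (by decide) (by decide)
    (by decide) hd₂.n₁ hL.n₁_le (by simpa [write] using h₀) ?_) ?_
  · rintro s τ hs hτ hS hf ⟨h₁, h₂⟩
    have hdτ : Ready d τ := hd₂.congr fun a ha h1 => hf a (by omega) (by revert a; decide)
    have hfr : ∀ a, 26 < a → a < 43 → a ≠ rIdx → τ a = σ a := fun a g₁ g₂ g₃ => by
      rw [hf a (by omega) (by simp [Prog.writes]; omega), fr a (by omega) (by omega)]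
    have hpol : τ rPol = σ rPol := by apply hfr <;> decide
    have hgain : τ rGain = σ rGain := by apply hfr <;> decide
    have hrest : τ rRest = σ rRest := by apply hfr <;> decide
    have hoff := hdτ.off s hs.le
    have g₁ := hG (s + 1) hs
    have g₂ := hR (s + 1) hs
    obtain ⟨h₃, h₄⟩ := htab s hs
    rw [Finset.sum_range_succ] at g₁ g₂
    refine WP.set_seq hτ ?_ fun hτ₁ => ?_
    · simpa [hS, hoff, hpol] using (off_add_lt hs (hπ s hs)).trans
        (hL.E_lt.trans_le (Nat.pow_le_pow_right (by norm_num) (by omega)))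
    refine WP.set_seq hτ₁ ?_ fun hτ₂ => ?_
    · simpa [write, hS, hoff, hpol, hgain, h₁, h₃] using g₁
    refine WP.set hτ₂ ?_ ?_
    · simpa [write, hS, hoff, hpol, hrest, h₂, h₄] using g₂
    · simp [write, hS, hoff, hpol, hgain, hrest, h₁, h₂, h₃, h₄, Finset.sum_range_succ]
  · rintro τ hτ _ ⟨h₁, h₂⟩
    refine WP.set hτ ?_ ?_
    · simpa using (Nat.sub_le _ _).trans_lt (hτ _ _)
    · simp [write, hmin, h₁, h₂, score]

theorem WP.keepBest (hL : d.Fits b L) (hσ : Bounded B σ) (hd : Ready d σ) :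
    WP B L keepBest (fun τ => (τ rOut 0 = σ rOut 0) ∧
      (σ rBest 0 < σ rScore 0 ∧ τ rBest 0 = σ rScore 0 ∧ τ rOut 1 = σ rInit 0 ∧
        (∀ s < d.n₁, τ rOut (s + 2) = σ rPol s) ∨
      σ rScore 0 ≤ σ rBest 0 ∧ τ rBest = σ rBest ∧ τ rOut = σ rOut)) σ := by
  unfold RAM.keepBest
  refine WP.ite hσ (fun hne => ?_) (fun he => ?_)
  · have hlt : σ rBest 0 < σ rScore 0 := by
      simp at hne
      omega
    refine WP.set_seq hσ (by simpa using hσ _ _) fun hσ₁ => ?_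
    refine WP.set_seq hσ₁ (by simpa using hσ₁ _ _) fun hσ₂ => ?_
    generalize hσ₂E : write (write σ _ _ _) _ _ _ = σ₂ at hσ₂ ⊢
    have fr : ∀ a, a ≠ rBest → a ≠ rOut → σ₂ a = σ a := fun a h₁ h₂ => by
      subst hσ₂E; funext j; simp [write, h₁, h₂]
    have hbest : σ₂ rBest 0 = σ rScore 0 := by subst hσ₂E; simp [write]
    have hout₀ : σ₂ rOut 0 = σ rOut 0 := by subst hσ₂E; simp [write]
    have hout₁ : σ₂ rOut 1 = σ rInit 0 := by subst hσ₂E; simp [write]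
    clear hσ₂E
    have hd₂ : Ready d σ₂ := hd.congr fun a ha h1 => fr a (by omega) h1
    refine (WP.for (N := d.n₁) (fun k τ => τ rOut 0 = σ rOut 0 ∧ τ rOut 1 = σ rInit 0 ∧
      ∀ s < k, τ rOut (s + 2) = σ rPol s) hσ₂ (by decide) (by decide) (by decide) hd₂.n₁ hL.n₁_le
      (by simp [write, hout₀, hout₁]) ?_).mono ?_
    · rintro s τ hs hτ hS hf ⟨h₁, h₂, h₃⟩
      have hpol : τ rPol = σ rPol := by
        rw [hf _ (by decide) (by decide), fr _ (by decide) (by decide)]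
      refine WP.set hτ (by simpa using hτ _ _) ?_
      refine ⟨by simp [write, hS, h₁], by simp [write, hS, h₂], ?_⟩
      intro s' hs'
      rcases Nat.lt_succ_iff_lt_or_eq.1 hs' with h | rfl
      · have : s' ≠ s := by omega
        simp [write, hS, this, h₃ s' h]
      · simp [write, hS, hpol]
    · rintro ω hω hf ⟨h₁, h₂, h₃⟩
      exact ⟨h₁, .inl ⟨hlt, by rw [hf _ (by decide), hbest], h₂, h₃⟩⟩
  · have hle : σ rScore 0 ≤ σ rBest 0 := by
      simp at he
      omega
    exact WP.skip hσ ⟨rfl, .inr ⟨hle, rfl, rfl⟩⟩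

end RAM

/-! ### The numbering of the candidates -/

namespace ScaledInstance

/-- The number of a candidate: an action at the initial state, a terminal state, a state-action pair with
the largest gain and a sum of rounded gains. -/
def code (d : ScaledInstance) (a₀ t e x : ℕ) : ℕ := ((a₀ * d.n₂ + t) * d.E + e) * d.T + x

/-- The sum of the gains of `ρ`, rounded relative to the number `M`. -/
def roundedSum (d : ScaledInstance) (a₀ t M : ℕ) (ρ : ℕ → ℕ) : ℕ :=
  ∑ s ∈ Finset.range d.n₁, min (d.gain a₀ t s (ρ s)) M * (d.K * d.n₁) / M

/-- A policy of score `best` is nearly as good as all policies that belong to the candidate `c`. -/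
def Covers (d : ScaledInstance) (c best : ℕ) : Prop :=
  ∀ a₀ t i ρ, d.IsPolicy ρ → i < d.n₁ → t < d.n₂ →
    (∀ s < d.n₁, d.gain a₀ t s (ρ s) ≤ d.gain a₀ t i (ρ i)) →
    c = d.code a₀ t (d.off i + ρ i) (d.roundedSum a₀ t (d.gain a₀ t i (ρ i)) ρ) →
    (d.K - 1) * d.score a₀ t ρ ≤ d.K * best

variable {d : ScaledInstance}

theorem Covers.mono {c b b' : ℕ} (h : d.Covers c b) (hb : b ≤ b') : d.Covers c b' :=
  fun a₀ t i ρ h₁ h₂ h₃ h₄ h₅ => (h a₀ t i ρ h₁ h₂ h₃ h₄ h₅).trans (Nat.mul_le_mul_left _ hb)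

theorem roundedSum_lt (a₀ t M : ℕ) (ρ : ℕ → ℕ) : d.roundedSum a₀ t M ρ < d.T := by
  have h : d.roundedSum a₀ t M ρ ≤ d.n₁ * (d.K * d.n₁) := by
    have := Finset.sum_le_card_nsmul (Finset.range d.n₁)
      (fun s => min (d.gain a₀ t s (ρ s)) M * (d.K * d.n₁) / M) (d.K * d.n₁) fun s _ =>
        Nat.div_le_of_le_mul (Nat.mul_le_mul_right _ (min_le_right _ _))
    simpa [roundedSum] using this
  have : d.T = d.n₁ * (d.K * d.n₁) + 1 := by unfold T; ring
  omega

theorem decode_code {a₀ t e x : ℕ} (ht : t < d.n₂) (he : e < d.E) (hx : x < d.T) :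
    d.code a₀ t e x % d.T = x ∧ d.code a₀ t e x / d.T % d.E = e ∧
      d.code a₀ t e x / d.T / d.E % d.n₂ = t ∧ d.code a₀ t e x / d.T / d.E / d.n₂ = a₀ := by
  have key : ∀ {y z w : ℕ}, z < w → (y * w + z) / w = y ∧ (y * w + z) % w = z := fun {y z w} h =>
    (Nat.div_mod_unique (by omega)).2 ⟨by ring, h⟩
  obtain ⟨h₁, h₂⟩ := key (y := (a₀ * d.n₂ + t) * d.E + e) hx
  obtain ⟨h₃, h₄⟩ := key (y := a₀ * d.n₂ + t) he
  obtain ⟨h₅, h₆⟩ := key (y := a₀) ht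
  unfold code
  exact ⟨h₂, by rw [h₁, h₄], by rw [h₁, h₃, h₆], by rw [h₁, h₃, h₅]⟩

theorem code_lt {a₀ t e x : ℕ} (ha : a₀ < d.m₀) (ht : t < d.n₂) (he : e < d.E) (hx : x < d.T) :
    d.code a₀ t e x < d.total := by
  have key : ∀ {y z w v : ℕ}, y < v → z < w → y * w + z < v * w := fun {y z w v} h h' =>
    calc y * w + z < (y + 1) * w := by rw [Nat.succ_mul]; omega
      _ ≤ v * w := Nat.mul_le_mul_right _ h
  exact key (key (key ha ht) he) hx

end ScaledInstance

/-! ### Correctness for one candidate and for the search over all candidates -/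

namespace RAM

open ScaledInstance

variable {d : ScaledInstance} {σ τ : Memory} {b B L : ℕ}

/-- The trace is a legal policy for every target, and its score is computed from the exact gains, so
meaningless candidates do no harm. If the candidate belongs to `ρ`, the rounding uses the largest
gain of `ρ` and the target is the rounded sum of `ρ`; then `IsTable.optimal` and the rounding lemma
apply. -/
theorem WP.candidate (hB : 5 * b + 2 ≤ B) (hL : d.Fits b L) (hσ : Bounded B σ) (hd : Ready d σ)
    (hm : ∀ s < d.n₁, 0 < d.m s) :
    WP B L candidate (fun τ => τ rOut 0 = σ rOut 0 ∧ ∃ π, d.IsPolicy π ∧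
      ∃ sc, sc = d.score (σ rC 0 / d.T / d.E / d.n₂) (σ rC 0 / d.T / d.E % d.n₂) π ∧
      d.Covers (σ rC 0) sc ∧
      (σ rBest 0 < sc ∧ τ rBest 0 = sc ∧ τ rOut 1 = σ rC 0 / d.T / d.E / d.n₂ ∧
        (∀ s < d.n₁, τ rOut (s + 2) = π s) ∨
      sc ≤ σ rBest 0 ∧ τ rBest = σ rBest ∧ τ rOut = σ rOut)) σ := by
  set c := σ rC 0 with hc
  set a₀ := c / d.T / d.E / d.n₂ with ha₀
  set t := c / d.T / d.E % d.n₂ with ht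
  unfold RAM.candidate
  refine WP.seq (WP.decodeCandidate hσ hd) fun σ₁ hσ₁ hf₁ ⟨hX, hItem, hTerm, hInit⟩ => ?_
  have hd₁ : Ready d σ₁ := hd.congr fun a ha h1 => hf₁ a (by revert a; decide)
  refine WP.seq (WP.table (by omega) hL hσ₁ hd₁ hInit hTerm) fun σ₂ hσ₂ hf₂ ⟨htab, hbig, hbigπ⟩ => ?_
  have hd₂ : Ready d σ₂ := hd₁.congr fun a ha h1 => hf₂ a (by revert a; decide)
  refine WP.seq (WP.roundGains (by omega) hL hσ₂ hd₂) fun σ₃ hσ₃ hf₃ hround => ?_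
  have hd₃ : Ready d σ₃ := hd₂.congr fun a ha h1 => hf₃ a (by revert a; decide)
  have hrest₃ : σ₃ rRest = σ₂ rRest := hf₃ _ (by decide)
  have hgain₃ : σ₃ rGain = σ₂ rGain := hf₃ _ (by decide)
  have hbig₃ : σ₃ rBig = σ₂ rBig := hf₃ _ (by decide)
  refine WP.seq (WP.dp hB hL hσ₃ hd₃ hm ?_ ?_) fun σ₄ hσ₄ hf₄ hdp => ?_
  · intro s hs a ha
    rw [hrest₃, (htab s hs a ha).2]
    exact (hL.rest_lt _ _ _ _).le
  · rwa [hbig₃]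
  have hd₄ : Ready d σ₄ := hd₃.congr fun a ha h1 => hf₄ a (by revert a; decide)
  refine WP.seq (WP.reconstruct hL hσ₄ hd₄) fun σ₅ hσ₅ hf₅ ⟨hY, htr⟩ => ?_
  have hd₅ : Ready d σ₅ := hd₄.congr fun a ha h1 => hf₅ a (by revert a; decide)
  have hround₄ : σ₄ rRound = σ₃ rRound := hf₄ _ (by decide)
  rw [hround₄] at htr
  have hY' : σ₅ rY d.n₁ = c % d.T := by
    rw [hY, hf₄ _ (by decide), hf₃ _ (by decide), hf₂ _ (by decide), hX]
  have hTpos : 0 < d.T := Nat.succ_pos _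
  have hYlt : σ₅ rY d.n₁ < d.T := hY' ▸ Nat.mod_lt _ hTpos
  have hπ : d.IsPolicy (σ₅ rPol) := hdp.isPolicy_of_traces htr hYlt
  have hgain₅ : σ₅ rGain = σ₂ rGain := by rw [hf₅ _ (by decide), hf₄ _ (by decide), hgain₃]
  have hrest₅ : σ₅ rRest = σ₂ rRest := by rw [hf₅ _ (by decide), hf₄ _ (by decide), hrest₃]
  refine WP.seq (WP.evaluate (by omega) hL hσ₅ hd₅ (a₀ := a₀) (t := t) ?_ hπ)
    fun σ₆ hσ₆ hf₆ hscore => ?_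
  · intro s hs
    rw [hgain₅, hrest₅]
    exact htab s hs _ (hπ s hs)
  have hd₆ : Ready d σ₆ := hd₅.congr fun a ha h1 => hf₆ a (by revert a; decide)
  refine (WP.keepBest hL hσ₆ hd₆).mono fun σ₇ hσ₇ hf₇ ⟨hout, hcase⟩ => ?_
  have hback : ∀ a, (a = rOut ∨ a = rBest) → σ₆ a = σ a := fun a ha => by
    rw [hf₆ a (by rcases ha with rfl | rfl <;> decide), hf₅ a (by rcases ha with rfl | rfl <;> decide),
      hf₄ a (by rcases ha with rfl | rfl <;> decide), hf₃ a (by rcases ha with rfl | rfl <;> decide),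
      hf₂ a (by rcases ha with rfl | rfl <;> decide), hf₁ a (by rcases ha with rfl | rfl <;> decide)]
  have hinit₆ : σ₆ rInit 0 = a₀ := by
    rw [hf₆ _ (by decide), hf₅ _ (by decide), hf₄ _ (by decide), hf₃ _ (by decide),
      hf₂ _ (by decide), hInit]
  have hpol₆ : σ₆ rPol = σ₅ rPol := hf₆ _ (by decide)
  rw [hback rOut (.inl rfl), hback rBest (.inr rfl), hscore, hinit₆, hpol₆] at hcase
  rw [hback rOut (.inl rfl)] at hout
  refine ⟨hout, σ₅ rPol, hπ, _, rfl, ?_, hcase⟩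
  intro a₀' t' i ρ hρ hi ht' hmax hcode
  have hitem : d.off i + ρ i < d.E := off_add_lt hi (hρ i hi)
  obtain ⟨e₁, e₂, e₃, e₄⟩ := decode_code (a₀ := a₀') ht' hitem
    (roundedSum_lt a₀' t' (d.gain a₀' t' i (ρ i)) ρ)
  rw [← hcode] at e₁ e₂ e₃ e₄
  rw [← ha₀] at e₄
  rw [← ht] at e₃
  subst e₃ e₄
  have hroundE : ∀ s < d.n₁, ∀ a < d.m s, σ₃ rRound (d.off s + a) =
      min (d.gain a₀ t s a) (d.gain a₀ t i (ρ i)) * (d.K * d.n₁) / d.gain a₀ t i (ρ i) := by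
    intro s hs a ha
    rw [hround _ (off_add_lt hs ha), hf₂ rItem (by decide), hItem, e₂, (htab s hs a ha).1,
      (htab i hi _ (hρ i hi)).1]
  obtain ⟨o₁, o₂⟩ := hdp.optimal (π := ρ) (y := σ₅ rY) (ρ := σ₅ rPol) (fun π hπ => by
    rw [hbig₃]
    refine lt_of_eq_of_lt (Finset.sum_congr rfl fun s hs => ?_) (hbigπ π hπ)
    rw [Finset.mem_range] at hs
    rw [hrest₃, (htab s hs _ (hπ s hs)).2]) htr hYlt hρ (by
      rw [hY', e₁]
      refine Finset.sum_congr rfl fun s hs => ?_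
      rw [Finset.mem_range] at hs
      rw [hroundE s hs _ (hρ s hs)])
  have hG : (d.K - 1) * ∑ s ∈ Finset.range d.n₁, d.gain a₀ t s (ρ s) ≤
      d.K * ∑ s ∈ Finset.range d.n₁, d.gain a₀ t s (σ₅ rPol s) := by
    refine sub_one_mul_sum_le_of_rounded hi rfl hmax ?_
    convert o₁ using 1 <;>
    · refine Finset.sum_congr rfl fun s hs => ?_
      rw [Finset.mem_range] at hs
      rw [hroundE s hs _ (by first | exact hρ s hs | exact hπ s hs)]
  have hR : ∑ s ∈ Finset.range d.n₁, d.rest a₀ t s (ρ s) ≤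
      ∑ s ∈ Finset.range d.n₁, d.rest a₀ t s (σ₅ rPol s) := by
    convert o₂ using 1 <;>
    · refine Finset.sum_congr rfl fun s hs => ?_
      rw [Finset.mem_range] at hs
      rw [hrest₃, (htab s hs _ (by first | exact hρ s hs | exact hπ s hs)).2]
  -- The rests do not decrease and the gains lose the factor `(K - 1) / K`; both pass to the
  -- minimum.
  unfold score
  refine le_trans (le_min ((Nat.mul_le_mul_left _ (min_le_left _ _)).trans hG) ?_)
    (Nat.mul_min_mul_left d.K _ _).le
  exact (Nat.mul_le_mul (Nat.sub_le _ _) (min_le_right _ _)).trans (Nat.mul_le_mul_left _ hR)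

/-- The memory presents a policy whose score is nearly optimal. -/
def Solved (d : ScaledInstance) (τ : Memory) : Prop :=
  τ rOut 0 = d.n₁ + 1 ∧ ∃ a₀ π best, a₀ < d.m₀ ∧ d.IsPolicy π ∧ τ rOut 1 = a₀ ∧
    (∀ s < d.n₁, τ rOut (s + 2) = π s) ∧ (best = 0 ∨ ∃ t < d.n₂, best = d.score a₀ t π) ∧
    ∀ a₀' < d.m₀, ∀ t < d.n₂, ∀ ρ, d.IsPolicy ρ → (d.K - 1) * d.score a₀' t ρ ≤ d.K * best

theorem WP.candidates (hB : 5 * b + 2 ≤ B) (hL : d.Fits b L) (hσ : Bounded B σ) (hd : Ready d σ)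
    (hm : ∀ s < d.n₁, 0 < d.m s) (hm₀ : 0 < d.m₀) (hn₁ : 0 < d.n₁) (hout : σ rOut 0 = d.n₁ + 1)
    (hzero : ∀ i, σ rOut (i + 1) = 0) (hbest : σ rBest 0 = 0) :
    WP B L (.for rC rTotal RAM.candidate) (Solved d) σ := by
  refine (WP.for (N := d.total) (fun c τ => τ rOut 0 = d.n₁ + 1 ∧ ∃ a₀ π, a₀ < d.m₀ ∧
    d.IsPolicy π ∧ τ rOut 1 = a₀ ∧ (∀ s < d.n₁, τ rOut (s + 2) = π s) ∧
    (τ rBest 0 = 0 ∨ ∃ t < d.n₂, τ rBest 0 = d.score a₀ t π) ∧ ∀ c' < c, d.Covers c' (τ rBest 0)) hσ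
    (by decide) (by decide) (by decide) hd.total hL.total_le ?_ ?_).mono ?_
  -- The output registers are initially zero, and action `0` is legal everywhere, so a policy is
  -- presented from the start.
  · refine ⟨by simpa [write] using hout, 0, fun _ => 0, hm₀, hm, ?_, ?_, .inl ?_, by simp⟩
    · simpa [write] using hzero 0
    · intro s _
      simpa [write] using hzero (s + 1)
    · simpa [write] using hbest
  · rintro c τ hc hτ hC hf ⟨h₀, a₀, π, h₁, h₂, h₃, h₄, h₅, h₆⟩
    have hdτ : Ready d τ := hd.congr fun a ha h1 => hf a (by omega) (by revert a; decide)
    refine (WP.candidate hB hL hτ hdτ hm).mono ?_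
    rw [hC]
    rintro ω hω hfω ⟨g₀, ρ, hρ, sc, hsc, hcov, hcase⟩
    have hw : write ω rC 0 (c + 1) rOut = ω rOut := by funext j; simp [write]
    have hw' : write ω rC 0 (c + 1) rBest = ω rBest := by funext j; simp [write]
    rw [hw, hw']
    -- Every number below `total` decodes to a legal initial action and terminal state, also if it
    -- belongs to no policy.
    have hdiv : c / d.T / d.E < d.m₀ * d.n₂ := by
      rw [Nat.div_div_eq_div_mul]
      apply Nat.div_lt_of_lt_mul
      unfold total at hc
      calc c < _ := hc
        _ = _ := by ring
    refine ⟨g₀.trans h₀, ?_⟩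
    rcases hcase with ⟨hlt, k₁, k₂, k₃⟩ | ⟨hle, k₁, k₂⟩
    · refine ⟨c / d.T / d.E / d.n₂, ρ, Nat.div_lt_of_lt_mul (by rwa [mul_comm]), hρ, k₂, k₃,
        .inr ⟨_, Nat.mod_lt _ ?_, k₁.trans hsc⟩, ?_⟩
      · exact Nat.pos_of_ne_zero fun h => by simp [h] at hdiv
      · intro c' hc'
        rw [k₁]
        rcases Nat.lt_succ_iff_lt_or_eq.1 hc' with h | rfl
        · exact (h₆ c' h).mono hlt.le
        · exact hcov
    · rw [k₁, k₂]
      refine ⟨a₀, π, h₁, h₂, h₃, h₄, h₅, ?_⟩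
      intro c' hc'
      rcases Nat.lt_succ_iff_lt_or_eq.1 hc' with h | rfl
      · exact h₆ c' h
      · exact hcov.mono hle
  · rintro τ hτ hf ⟨h₀, a₀, π, h₁, h₂, h₃, h₄, h₅, h₆⟩
    refine ⟨h₀, a₀, π, _, h₁, h₂, h₃, h₄, h₅, ?_⟩
    intro a₀' ha₀' t ht ρ hρ
    -- The state where `ρ` has its largest gain supplies the pair in the candidate that covers `ρ`.
    obtain ⟨i, hi, hmax⟩ := Finset.exists_max_image (Finset.range d.n₁)
      (fun s => d.gain a₀' t s (ρ s)) ⟨0, by simpa using hn₁⟩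
    rw [Finset.mem_range] at hi
    exact h₆ _ (code_lt ha₀' ht (off_add_lt hi (hρ i hi)) (roundedSum_lt _ _ _ _)) a₀' t i ρ hρ hi ht
      (fun s hs => hmax s (Finset.mem_range.2 hs)) rfl

/-! ### Reading and scaling the input -/

/-- The instance that the program builds from the input registers. -/
def scaledInput (K : ℕ) (inp : ℕ → ℕ) (J D : ℕ) : ScaledInstance where
  K := K
  n₁ := inp 1
  n₂ := inp 2
  m₀ := inp 3
  m s := inp (s + 4)
  q j := if j < J then inp (inp 1 + 4 + 2 * j) * (D / inp (inp 1 + 4 + (2 * j + 1))) else 0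

theorem WP.prepare {K J D : ℕ} {inp : ℕ → ℕ} (hB : b ≤ B) (hd : d = scaledInput K inp J D)
    (hL : d.Fits b L) (hσ : Bounded B σ) (hinp : σ rIn = inp)
    (hJ : (inp 0 - (inp 1 + 3)) / 2 = J) (hJL : J ≤ L)
    (hD : ∏ j ∈ Finset.range J, inp (inp 1 + 4 + (2 * j + 1)) = D)
    (hpos : ∀ j < J, 0 < inp (inp 1 + 4 + (2 * j + 1)))
    (hDB : D < 2 ^ B) (hK : σ rK 0 = K) (hq : ∀ j, σ rQ j = 0) (hoff : σ rOff 0 = 0)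
    (hzero : ∀ i, σ rOut (i + 1) = 0)
    (hn₁ : inp 1 + 4 < 2 ^ B) (halt : d.alt < 2 ^ B) :
    WP B L prepare (fun τ => Ready d τ ∧ τ rOut 0 = d.n₁ + 1 ∧ ∀ i, τ rOut (i + 1) = 0) σ := by
  have hbB : 2 ^ b ≤ 2 ^ B := Nat.pow_le_pow_right (by norm_num) hB
  unfold RAM.prepare
  refine WP.set_seq hσ (by simpa using hσ _ _) fun h₁ => ?_
  refine WP.set_seq h₁ (by simpa using h₁ _ _) fun h₂ => ?_
  refine WP.set_seq h₂ (by simpa using h₂ _ _) fun h₃ => ?_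
  refine WP.set_seq h₃ (by simpa [write, hinp] using hn₁) fun h₄ => ?_
  refine WP.set_seq h₄ ?_ fun h₅ => ?_
  · simpa using ((Nat.div_le_self _ _).trans (Nat.sub_le _ _)).trans_lt (h₄ rIn 0)
  refine WP.set_seq h₅ (by change 1 < 2 ^ B; omega) fun hσ₁ => ?_
  generalize hσ₁E : write (write _ _ _ _) _ _ _ = σ₁ at hσ₁ ⊢
  have f₁ : ∀ a, a < 3 ∨ 8 < a → σ₁ a = σ a := fun a ha => by
    subst hσ₁E
    funext j
    have g : a ≠ 3 ∧ a ≠ 4 ∧ a ≠ 5 ∧ a ≠ 6 ∧ a ≠ 7 ∧ a ≠ 8 := by omega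
    simp [write, g]
  have hN₁ : σ₁ rN₁ 0 = inp 1 := by subst hσ₁E; simp [write, hinp]
  have hN₂ : σ₁ rN₂ 0 = inp 2 := by subst hσ₁E; simp [write, hinp]
  have hM₀ : σ₁ rM₀ 0 = inp 3 := by subst hσ₁E; simp [write, hinp]
  have hHead : σ₁ rHead 0 = inp 1 + 4 := by subst hσ₁E; simp [write, hinp]
  have hCount : σ₁ rCount 0 = J := by subst hσ₁E; simp [write, hinp, hJ]
  have hDen : σ₁ rDen 0 = 1 := by subst hσ₁E; simp [write]
  clear hσ₁E
  -- Since the denominators are positive, the partial products are at most `D` and fit into the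
  -- register.
  have hprod : ∀ k ≤ J, ∏ j ∈ Finset.range k, inp (inp 1 + 4 + (2 * j + 1)) ≤ D := fun k hk => by
    rw [← hD]
    exact Finset.prod_le_prod_of_subset_of_one_le' (Finset.range_mono hk)
      fun j hj _ => hpos j (Finset.mem_range.1 hj)
  refine WP.seq (WP.for (N := J) (fun k τ => τ rDen 0 =
    ∏ j ∈ Finset.range k, inp (inp 1 + 4 + (2 * j + 1))) hσ₁ (by decide) (by decide) (by decide)
    hCount hJL (by simpa [write] using hDen) ?_) fun σ₂ hσ₂ hf₂ hD₂ => ?_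
  · intro k τ hk hτ hI hf hinv
    have hinpτ : τ rIn = inp := by rw [hf _ (by decide) (by decide), f₁ _ (by decide), hinp]
    have hHeadτ : τ rHead 0 = inp 1 + 4 := by rw [hf _ (by decide) (by decide), hHead]
    have hle := (hprod (k + 1) hk).trans_lt hDB
    rw [Finset.prod_range_succ] at hle
    refine WP.set hτ ?_ ?_
    · simpa [hI, hinv, hHeadτ, hinpτ] using hle
    · simp [write, hI, hinv, hHeadτ, hinpτ, Finset.prod_range_succ]
  have f₂ : ∀ a, a ≠ rDen → a ≠ rI → σ₂ a = σ₁ a := fun a g₁ g₂ =>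
    hf₂ a (by simp [Prog.for, Prog.writes, g₁, g₂])
  rw [hD] at hD₂
  have hqd : ∀ j < J, d.q j = inp (inp 1 + 4 + 2 * j) * (D / inp (inp 1 + 4 + (2 * j + 1))) :=
    fun j hj => by rw [hd]; simp [scaledInput, hj]
  have hqd' : ∀ j, ¬ j < J → d.q j = 0 := fun j hj => by rw [hd]; simp [scaledInput, hj]
  refine WP.seq (WP.for (N := J) (fun k τ => ∀ j, τ rQ j = if j < k then d.q j else 0) hσ₂
    (by decide) (by decide) (by decide)
    (by rw [f₂ _ (by decide) (by decide), hCount]) hJL ?_ ?_) fun σ₃ hσ₃ hf₃ hQ₃ => ?_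
  · intro j
    have : σ₂ rQ j = 0 := by rw [f₂ _ (by decide) (by decide), f₁ _ (by decide), hq]
    simp [write, this]
  · intro k τ hk hτ hI hf hinv
    have hinpτ : τ rIn = inp := by
      rw [hf _ (by decide) (by decide), f₂ _ (by decide) (by decide), f₁ _ (by decide), hinp]
    have hHeadτ : τ rHead 0 = inp 1 + 4 := by
      rw [hf _ (by decide) (by decide), f₂ _ (by decide) (by decide), hHead]
    have hDτ : τ rDen 0 = D := by rw [hf _ (by decide) (by decide), hD₂]
    have hlt := (hL.q_lt k).trans_le hbB
    have hqk := hqd k hk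
    refine WP.set hτ ?_ ?_
    · simpa [hI, hHeadτ, hinpτ, hDτ, hqk] using hlt
    · intro j
      rcases eq_or_ne j k with rfl | hne
      · simp [write, hI, hHeadτ, hinpτ, hDτ, hqk]
      · have h₁ : j < k + 1 ↔ j < k := by omega
        simp [write, hI, hne, hinv j, h₁]
  have f₃ : ∀ a, a ≠ rDen → a ≠ rI → a ≠ rQ → σ₃ a = σ₁ a := fun a g₁ g₂ g₃ => by
    rw [hf₃ a (by simp [Prog.for, Prog.writes, g₂, g₃]), f₂ a g₁ g₂]
  have hN₁d : d.n₁ = inp 1 := by rw [hd]; rfl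
  have hN₂d : d.n₂ = inp 2 := by rw [hd]; rfl
  have hM₀d : d.m₀ = inp 3 := by rw [hd]; rfl
  have hKd : d.K = K := by rw [hd]; rfl
  have hmd : ∀ s, inp (s + 4) = d.m s := fun s => by rw [hd]; rfl
  refine WP.seq (WP.for (N := d.n₁) (fun k τ => ∀ s ≤ k, τ rOff s = d.off s) hσ₃
    (by decide) (by decide) (by decide)
    (by rw [f₃ _ (by decide) (by decide) (by decide), hN₁, hN₁d]) hL.n₁_le ?_ ?_)
    fun σ₄ hσ₄ hf₄ hOff => ?_
  · intro s hs
    obtain rfl : s = 0 := by omega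
    have : σ₃ rOff 0 = 0 := by
      rw [f₃ _ (by decide) (by decide) (by decide), f₁ _ (by decide), hoff]
    simp [write, this, off]
  · intro k τ hk hτ hI hf hinv
    have hinpτ : τ rIn = inp := by
      rw [hf _ (by decide) (by decide), f₃ _ (by decide) (by decide) (by decide), f₁ _ (by decide),
        hinp]
    have hlt : d.off k + d.m k < 2 ^ B := by
      rw [← off_succ]
      exact (off_mono hk).trans_lt (hL.E_lt.trans_le hbB)
    have hk' := hinv k le_rfl
    refine WP.set hτ ?_ ?_
    · simpa [hI, hinpτ, hmd, hk'] using hlt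
    · intro s hs
      rcases eq_or_ne s (k + 1) with rfl | hne
      · simp [write, hI, hinpτ, hmd, hk', off_succ]
      · have := hinv s (by omega)
        simp [write, hI, hne, this]
  have f₄ : ∀ a, a ≠ rDen → a ≠ rI → a ≠ rQ → a ≠ rOff → a ≠ rS → σ₄ a = σ₁ a :=
    fun a g₁ g₂ g₃ g₄ g₅ => by
      rw [hf₄ a (by simp [Prog.for, Prog.writes, g₄, g₅]), f₃ a g₁ g₂ g₃]
  have kIn : σ₄ rIn = inp := by rw [f₄ _, f₁ _, hinp] <;> decide
  have kOut : ∀ i, σ₄ rOut (i + 1) = 0 := fun i => by rw [f₄ _, f₁ _, hzero] <;> decide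
  have kK : σ₄ rK 0 = d.K := by rw [f₄ _, f₁ _, hK, hKd] <;> decide
  have kN₁ : σ₄ rN₁ 0 = d.n₁ := by rw [f₄ _, hN₁, hN₁d] <;> decide
  have kN₂ : σ₄ rN₂ 0 = d.n₂ := by rw [f₄ _, hN₂, hN₂d] <;> decide
  have kM₀ : σ₄ rM₀ 0 = d.m₀ := by rw [f₄ _, hM₀, hM₀d] <;> decide
  have kQ : ∀ j, σ₄ rQ j = d.q j := fun j => by
    rw [hf₄ _ (by decide), hQ₃]
    split_ifs with h
    exacts [rfl, (hqd' j h).symm]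
  have kE : σ₄ rOff d.n₁ = d.E := hOff _ le_rfl
  have hE := hL.E_lt.trans_le hbB
  have hKN := hL.KN_lt.trans_le hbB
  have hT := hL.T_lt.trans_le hbB
  have htot := hL.total_lt.trans_le hbB
  have hpos' : d.m₀ * d.n₁ = d.pos := rfl
  have hnom : d.pos + d.E * d.n₂ = d.nom := rfl
  have halt' : d.nom + d.n₂ = d.alt := rfl
  have hT' : d.K * d.n₁ * d.n₁ + 1 = d.T := rfl
  have htot' : d.m₀ * d.n₂ * d.E * d.T = d.total := rfl
  refine WP.set_seq hσ₄ (by simpa [kN₁, kE] using hE) fun h₁ => ?_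
  refine WP.set_seq h₁ (by simp [write, kN₁, kM₀]; omega) fun h₂ => ?_
  refine WP.set_seq h₂ (by simp [write, kN₁, kM₀, kN₂, kE]; omega) fun h₃ => ?_
  refine WP.set_seq h₃ (by simp [write, kN₁, kM₀, kN₂, kE]; omega) fun h₄ => ?_
  refine WP.set_seq h₄ (by simpa [write, kN₁, kK] using hKN) fun h₅ => ?_
  refine WP.set_seq h₅ (by simpa [write, kN₁, kK, hT'] using hT) fun h₆ => ?_
  refine WP.set_seq h₆ (by simpa [write, kN₁, kK, kM₀, kN₂, kE, hT', htot'] using htot) fun h₇ => ?_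
  refine WP.set h₇ (by simp [write, kN₁]; omega) ⟨?_, by simp [write, kN₁], by simp [write, kOut]⟩
  constructor
  · simp [write, kIn, hmd]
  · simp [write, kK]
  · simp [write, kN₁]
  · simp [write, kN₂]
  · simp [write, kM₀]
  · simp [write, kQ]
  · intro s hs
    simp [write, hOff s hs]
  · simp [write, kN₁, kE]
  · simp [write, kN₁, kM₀, hpos']
  · simp [write, kN₁, kM₀, kN₂, kE, hpos', hnom]
  · simp [write, kN₁, kM₀, kN₂, kE, hpos', hnom, halt']
  · simp [write, kN₁, kK, hT']
  · simp [write, kN₁, kK]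
  · simp [write, kN₁, kK, kM₀, kN₂, kE, hT', htot']

end RAM

/-! ### Worst-case rewards -/

namespace TwoStageRewardDLP

variable {I : TwoStageRewardDLP}

theorem terminalProb_nonneg (π : I.Policy) (t : Fin I.n₂) : 0 ≤ terminalProb π t :=
  Finset.sum_nonneg fun _ _ => mul_nonneg (I.p₀_nonneg _ _) (I.p₁_nonneg _ _ _)

/-- The loss of the policy when the reward at `t` deviates. -/
def lossAt (π : I.Policy) (t : Fin I.n₂) : ℚ := terminalProb π t * (I.r t - I.r' t)

theorem lossAt_nonneg (π : I.Policy) (t : Fin I.n₂) : 0 ≤ lossAt π t :=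
  mul_nonneg (terminalProb_nonneg π t) (sub_nonneg.2 (I.r'_le_r t))

theorem lossAt_le (π : I.Policy) (t : Fin I.n₂) : lossAt π t ≤ terminalProb π t * I.r t :=
  mul_le_mul_of_nonneg_left (sub_le_self _ (I.r'_nonneg t)) (terminalProb_nonneg π t)

theorem le_expectedReward (π : I.Policy) {q : Fin I.n₂ → ℚ} (hq : ∀ t, 0 ≤ q t) (t : Fin I.n₂) :
    terminalProb π t * q t ≤ expectedReward π q :=
  Finset.single_le_sum (f := fun t => terminalProb π t * q t)
    (fun t _ => mul_nonneg (terminalProb_nonneg π t) (hq t)) (Finset.mem_univ t)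

theorem lossAt_le_reward (π : I.Policy) (t : Fin I.n₂) : lossAt π t ≤ reward π :=
  (lossAt_le π t).trans (le_expectedReward π (fun t => (I.r'_nonneg t).trans (I.r'_le_r t)) t)

theorem mem_uncertaintySet_one {q : Fin I.n₂ → ℚ} (hq : q ∈ I.uncertaintySet 1) :
    q = I.r ∨ ∃ t, q = Function.update I.r t (I.r' t) := by
  simp only [uncertaintySet, Finset.mem_filter, Fintype.mem_piFinset, Finset.mem_insert,
    Finset.mem_singleton] at hq
  obtain ⟨h₁, h₂⟩ := hq
  by_cases h : ∃ t, q t ≠ I.r t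
  · obtain ⟨t, ht⟩ := h
    refine .inr ⟨t, funext fun u => ?_⟩
    rcases eq_or_ne u t with rfl | hne
    · rw [Function.update_self]
      exact (h₁ u).resolve_left ht
    · rw [Function.update_of_ne hne]
      by_contra hu
      exact hne (Finset.card_le_one.1 h₂ u (by simpa using hu) t (by simpa using ht))
  · push Not at h
    exact .inl (funext h)

theorem expectedReward_update (π : I.Policy) (t : Fin I.n₂) :
    expectedReward π (Function.update I.r t (I.r' t)) = reward π - lossAt π t := by
  have h : ∀ u, terminalProb π u * Function.update I.r t (I.r' t) u =
      terminalProb π u * I.r u - if u = t then lossAt π t else 0 := by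
    intro u
    rcases eq_or_ne u t with rfl | hne
    · simp [lossAt]
      ring
    · simp [hne]
  simp [expectedReward, reward, h, Finset.sum_sub_distrib]

/-- If the deviation is at `t`, exactly `reward π - lossAt π t` remains. Otherwise the nominal
reward at `t` is still collected, and it is at least `lossAt π t` because `r' t ≥ 0`. -/
theorem min_lossAt_le_worstReward (π : I.Policy) (t : Fin I.n₂) :
    min (lossAt π t) (reward π - lossAt π t) ≤ worstReward π := by
  refine Finset.le_inf' _ _ fun q hq => ?_
  rcases mem_uncertaintySet_one hq with rfl | ⟨u, rfl⟩
  · exact (min_le_right _ _).trans (sub_le_self _ (lossAt_nonneg π t))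
  · rcases eq_or_ne u t with rfl | hne
    · rw [expectedReward_update]
      exact min_le_right _ _
    · refine (min_le_left _ _).trans ((lossAt_le π t).trans ?_)
      have := le_expectedReward π (q := Function.update I.r u (I.r' u)) (fun v => by
        rcases eq_or_ne v u with rfl | h
        · simpa using I.r'_nonneg v
        · simpa [h] using (I.r'_nonneg v).trans (I.r'_le_r v)) t
      rwa [Function.update_of_ne hne.symm] at this

theorem worstReward_nonneg (π : I.Policy) (t : Fin I.n₂) : 0 ≤ worstReward π :=
  (le_min (lossAt_nonneg π t) (sub_nonneg.2 (lossAt_le_reward π t))).trans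
    (min_lossAt_le_worstReward π t)

/-- For a worst-case deviation at `t` the two minima agree up to order. If the nominal rewards are
worst, the loss is `0` and any `t₀` serves. -/
theorem exists_min_le_min_lossAt (π : I.Policy) (t₀ : Fin I.n₂) :
    ∃ t, min (worstReward π) (loss π) ≤ min (lossAt π t) (reward π - lossAt π t) := by
  obtain ⟨q, hq, hw⟩ := Finset.exists_mem_eq_inf' (I.uncertaintySet_nonempty 1) (expectedReward π)
  change worstReward π = _ at hw
  rcases mem_uncertaintySet_one hq with rfl | ⟨t, rfl⟩
  · refine ⟨t₀, (min_le_right _ _).trans ?_⟩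
    have : loss π = 0 := by rw [loss, hw, reward, sub_self]
    rw [this]
    exact le_min (lossAt_nonneg π t₀) (sub_nonneg.2 (lossAt_le_reward π t₀))
  · refine ⟨t, le_of_eq ?_⟩
    rw [expectedReward_update] at hw
    rw [loss, hw, sub_sub_cancel, min_comm]

variable (I) in
theorem n₁_pos : 0 < I.n₁ := by
  by_contra h
  have : IsEmpty (Fin I.n₁) := ⟨fun s => h (Nat.zero_lt_of_lt s.2)⟩
  simpa using I.p₀_sum ⟨0, I.m₀_pos⟩

variable (I) in
theorem n₂_pos : 0 < I.n₂ := by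
  by_contra h
  have : IsEmpty (Fin I.n₂) := ⟨fun s => h (Nat.zero_lt_of_lt s.2)⟩
  simpa using I.p₁_sum ⟨0, I.n₁_pos⟩ ⟨0, I.m_pos _⟩

end TwoStageRewardDLP

/-! ### The encoding -/

section Blocks

variable {α : Type*}

theorem length_flatMap_finRange {n : ℕ} (f : Fin n → List α) {l : ℕ → ℕ}
    (hl : ∀ i, (f i).length = l i) :
    ((List.finRange n).flatMap f).length = ∑ k ∈ Finset.range n, l k := by
  rw [List.length_flatMap, ← Fin.sum_univ_eq_sum_range, ← List.sum_ofFn, List.ofFn_eq_map]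
  simp [hl]

/-- The block lengths are a function on `ℕ`, so that block positions become sums over
`Finset.range`, as in `offset`. -/
theorem getElem?_flatMap_finRange {n : ℕ} (f : Fin n → List α) {l : ℕ → ℕ}
    (hl : ∀ i, (f i).length = l i) (i : Fin n) {j : ℕ} (hj : j < l i) :
    ((List.finRange n).flatMap f)[∑ k ∈ Finset.range i, l k + j]? = (f i)[j]? := by
  induction n generalizing l with
  | zero => exact i.elim0
  | succ n ih =>
    rw [List.finRange_succ, List.flatMap_cons, List.flatMap_map]
    refine Fin.cases (fun hj => ?_) (fun i hj => ?_) i hj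
    · simp only [Fin.val_zero, Finset.range_zero, Finset.sum_empty, zero_add]
      rw [List.getElem?_append_left (by rw [hl]; exact hj)]
    · rw [Fin.val_succ, Finset.sum_range_succ', List.getElem?_append_right (by rw [hl]; simp; omega),
        hl, ← ih (fun i => f i.succ) (l := fun k => l (k + 1)) (fun i => hl i.succ) i hj]
      congr 1
      simp only [Fin.val_zero]
      omega

end Blocks

namespace TwoStageRewardDLP

theorem length_flatMap_encodeRat (l : List ℚ) : (l.flatMap encodeRat).length = 2 * l.length := by
  induction l with
  | nil => rfl
  | cons x l ih =>
    rw [List.flatMap_cons, List.length_append, ih, List.length_cons]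
    simp only [encodeRat, List.length_cons, List.length_nil]
    omega

theorem getElem?_flatMap_encodeRat (l : List ℚ) (j : ℕ) :
    (l.flatMap encodeRat)[2 * j]? = l[j]?.map (fun x => x.num.toNat) ∧
      (l.flatMap encodeRat)[2 * j + 1]? = l[j]?.map (fun x => x.den) := by
  induction l generalizing j with
  | nil => simp
  | cons x l ih =>
    rw [List.flatMap_cons]
    simp only [encodeRat]
    cases j with
    | zero => simp
    | succ j =>
      obtain ⟨h₁, h₂⟩ := ih j
      exact ⟨h₁, h₂⟩

variable (I : TwoStageRewardDLP)

/-- The first-stage probabilities. -/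
def firstStage : List ℚ := (List.finRange I.m₀).flatMap fun a => (List.finRange I.n₁).map (I.p₀ a)

/-- The second-stage probabilities. -/
def secondStage : List ℚ :=
  (List.finRange I.n₁).flatMap fun s =>
    (List.finRange (I.m s)).flatMap fun a => (List.finRange I.n₂).map (I.p₁ s a)

/-- The rational numbers in the encoding of an instance. -/
def rationals : List ℚ :=
  I.firstStage ++ (I.secondStage ++ ((List.finRange I.n₂).map I.r ++ (List.finRange I.n₂).map I.r'))

/-- With all rationals in one list, position `j` in the list is the index `j` used by the program
for its scaled numbers. -/
theorem encode_eq : I.encode = [I.n₁, I.n₂, I.m₀] ++ (List.ofFn I.m ++ I.rationals.flatMap encodeRat) := by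
  simp [encode, rationals, firstStage, secondStage, List.flatMap_assoc, List.flatMap_map]

/-- The numbers of actions. -/
def actions (s : ℕ) : ℕ := if h : s < I.n₁ then I.m ⟨s, h⟩ else 0

/-- The number of state-action pairs before state `s`. -/
def offset (s : ℕ) : ℕ := ∑ s' ∈ Finset.range s, I.actions s'

theorem actions_val (s : Fin I.n₁) : I.actions s = I.m s := by simp [actions]

theorem length_firstStage : I.firstStage.length = I.m₀ * I.n₁ := by
  rw [firstStage, length_flatMap_finRange (l := fun _ => I.n₁) _ (by simp)]
  simp

theorem length_secondStage : I.secondStage.length = I.offset I.n₁ * I.n₂ := by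
  rw [secondStage, length_flatMap_finRange (l := fun s => I.actions s * I.n₂), offset,
    Finset.sum_mul]
  intro s
  rw [length_flatMap_finRange (l := fun _ => I.n₂) _ (by simp), actions_val]
  simp

theorem length_rationals :
    I.rationals.length = I.m₀ * I.n₁ + I.offset I.n₁ * I.n₂ + I.n₂ + I.n₂ := by
  simp only [rationals, List.length_append, length_firstStage, length_secondStage, List.length_map,
    List.length_finRange]
  omega

theorem offset_add_lt (s : Fin I.n₁) (a : Fin (I.m s)) : I.offset s + a < I.offset I.n₁ :=
  calc I.offset s + a < I.offset s + I.actions s := by rw [actions_val]; omega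
    _ = I.offset (s + 1) := (Finset.sum_range_succ _ _).symm
    _ ≤ I.offset I.n₁ := Finset.sum_le_sum_of_subset (Finset.range_mono s.2)

theorem rationals_p₀ (a : Fin I.m₀) (s : Fin I.n₁) : I.rationals[a * I.n₁ + s]? = some (I.p₀ a s) := by
  have hlt : a * I.n₁ + s < I.firstStage.length := by
    rw [length_firstStage]
    calc a * I.n₁ + s < (a + 1) * I.n₁ := by rw [Nat.succ_mul]; omega
      _ ≤ _ := Nat.mul_le_mul_right _ a.2
  rw [rationals, List.getElem?_append_left hlt, firstStage]
  have := getElem?_flatMap_finRange (fun a => (List.finRange I.n₁).map (I.p₀ a))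
    (l := fun _ => I.n₁) (by simp) a (j := s) s.2
  simpa using this

theorem rationals_p₁ (s : Fin I.n₁) (a : Fin (I.m s)) (t : Fin I.n₂) :
    I.rationals[I.m₀ * I.n₁ + ((I.offset s + a) * I.n₂ + t)]? = some (I.p₁ s a t) := by
  have hlt : (I.offset s + a) * I.n₂ + t < I.secondStage.length := by
    rw [length_secondStage]
    calc (I.offset s + a) * I.n₂ + t < (I.offset s + a + 1) * I.n₂ := by rw [Nat.succ_mul]; omega
      _ ≤ _ := Nat.mul_le_mul_right _ (I.offset_add_lt s a)
  rw [rationals, List.getElem?_append_right (by rw [length_firstStage]; omega), length_firstStage,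
    Nat.add_sub_cancel_left, List.getElem?_append_left hlt, secondStage]
  have hj : a * I.n₂ + t < I.actions s * I.n₂ := by
    rw [actions_val]
    calc a * I.n₂ + t < (a + 1) * I.n₂ := by rw [Nat.succ_mul]; omega
      _ ≤ _ := Nat.mul_le_mul_right _ a.2
  have h₁ := getElem?_flatMap_finRange (fun s => (List.finRange (I.m s)).flatMap fun a =>
    (List.finRange I.n₂).map (I.p₁ s a)) (l := fun s => I.actions s * I.n₂) (by
      intro s
      rw [length_flatMap_finRange (l := fun _ => I.n₂) _ (by simp), actions_val]
      simp) s hj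
  have h₂ := getElem?_flatMap_finRange (fun a => (List.finRange I.n₂).map (I.p₁ s a))
    (l := fun _ => I.n₂) (by simp) a (j := t) t.2
  rw [← Finset.sum_mul, ← add_assoc, ← add_mul] at h₁
  rw [Finset.sum_const, Finset.card_range, smul_eq_mul] at h₂
  change _[(I.offset s + a) * I.n₂ + t]? = _ at h₁
  rw [h₁, h₂]
  simp

theorem rationals_r (t : Fin I.n₂) :
    I.rationals[I.m₀ * I.n₁ + I.offset I.n₁ * I.n₂ + t]? = some (I.r t) := by
  rw [rationals, List.getElem?_append_right (by rw [length_firstStage]; omega), length_firstStage,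
    List.getElem?_append_right (by rw [length_secondStage]; omega), length_secondStage,
    List.getElem?_append_left (by simp; omega),
    show I.m₀ * I.n₁ + I.offset I.n₁ * I.n₂ + t - I.m₀ * I.n₁ - I.offset I.n₁ * I.n₂ = t by omega]
  simp

theorem rationals_r' (t : Fin I.n₂) :
    I.rationals[I.m₀ * I.n₁ + I.offset I.n₁ * I.n₂ + I.n₂ + t]? = some (I.r' t) := by
  rw [rationals, List.getElem?_append_right (by rw [length_firstStage]; omega), length_firstStage,
    List.getElem?_append_right (by rw [length_secondStage]; omega), length_secondStage,
    List.getElem?_append_right (by simp; omega), List.length_map, List.length_finRange,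
    show I.m₀ * I.n₁ + I.offset I.n₁ * I.n₂ + I.n₂ + t - I.m₀ * I.n₁ - I.offset I.n₁ * I.n₂ - I.n₂ = t
      by omega]
  simp

theorem rationals_nonneg {x : ℚ} (hx : x ∈ I.rationals) : 0 ≤ x := by
  simp only [rationals, firstStage, secondStage, List.mem_append, List.mem_flatMap, List.mem_map,
    List.mem_finRange, true_and] at hx
  rcases hx with ⟨a, s, rfl⟩ | ⟨s, a, t, rfl⟩ | ⟨t, rfl⟩ | ⟨t, rfl⟩
  exacts [I.p₀_nonneg _ _, I.p₁_nonneg _ _ _, (I.r'_nonneg t).trans (I.r'_le_r t), I.r'_nonneg t]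

end TwoStageRewardDLP

/-! ### The input registers and the size of the scaled instance -/

namespace TwoStageRewardDLP

open RAM

variable (I : TwoStageRewardDLP)

/-- The input registers. -/
def input (i : ℕ) : ℕ := initMemory I.encode 0 i

theorem input_succ (i : ℕ) : I.input (i + 1) = (I.encode[i]?).getD 0 := by
  simp [input, initMemory, List.getD]

theorem length_encode : I.encode.length = 3 + I.n₁ + 2 * I.rationals.length := by
  rw [encode_eq]
  simp only [List.length_append, List.length_ofFn, length_flatMap_encodeRat, List.length_cons,
    List.length_nil]
  omega

theorem input_zero : I.input 0 = 3 + I.n₁ + 2 * I.rationals.length := by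
  rw [← length_encode]
  simp [input, initMemory]

theorem input_one : I.input 1 = I.n₁ := by simp [input_succ, encode_eq]

theorem input_two : I.input 2 = I.n₂ := by simp [input_succ, encode_eq]

theorem input_three : I.input 3 = I.m₀ := by simp [input_succ, encode_eq]

theorem input_actions {s : ℕ} (hs : s < I.n₁) : I.input (s + 4) = I.actions s := by
  rw [input_succ, encode_eq, List.getElem?_append_right (by simp), List.getElem?_append_left
    (by simpa using hs)]
  simp [hs, actions]

theorem encode_rationals (j : ℕ) :
    I.encode[I.n₁ + 3 + j]? = (I.rationals.flatMap encodeRat)[j]? := by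
  rw [encode_eq, List.getElem?_append_right (by simp; omega), List.getElem?_append_right
    (by simp; omega)]
  congr 1
  simp
  omega

theorem input_num {j : ℕ} {x : ℚ} (hx : I.rationals[j]? = some x) :
    I.input (I.input 1 + 4 + 2 * j) = x.num.toNat := by
  rw [input_one, show I.n₁ + 4 + 2 * j = I.n₁ + 3 + 2 * j + 1 by ring, input_succ, encode_rationals,
    (getElem?_flatMap_encodeRat _ j).1, hx]
  rfl

theorem input_den {j : ℕ} {x : ℚ} (hx : I.rationals[j]? = some x) :
    I.input (I.input 1 + 4 + (2 * j + 1)) = x.den := by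
  rw [input_one, show I.n₁ + 4 + (2 * j + 1) = I.n₁ + 3 + (2 * j + 1) + 1 by ring, input_succ,
    encode_rationals, (getElem?_flatMap_encodeRat _ j).2, hx]
  rfl

/-- The product of all denominators. -/
def commonDen : ℕ := (I.rationals.map Rat.den).prod

theorem prod_input_den :
    ∏ j ∈ Finset.range I.rationals.length, I.input (I.input 1 + 4 + (2 * j + 1)) = I.commonDen := by
  have h : I.rationals.map Rat.den = List.ofFn fun j : Fin I.rationals.length => I.rationals[j].den :=
    List.ext_getElem (by simp) (by simp)
  rw [commonDen, h, List.prod_ofFn,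
    ← Fin.prod_univ_eq_prod_range (fun j => I.input (I.input 1 + 4 + (2 * j + 1)))]
  exact Finset.prod_congr rfl fun j _ => I.input_den (List.getElem?_eq_getElem j.2)

theorem commonDen_pos : 0 < I.commonDen := by
  refine List.prod_pos fun x hx => ?_
  obtain ⟨y, -, rfl⟩ := List.mem_map.1 hx
  exact y.den_pos

theorem length_le_inputSize (x : List ℕ) : x.length ≤ inputSize x := by
  induction x with
  | nil => simp
  | cons a x ih => simp only [inputSize, List.map_cons, List.sum_cons, List.length_cons] at *; omega

theorem lt_two_pow_inputSize {x : List ℕ} {n : ℕ} (h : n ∈ x) : n < 2 ^ inputSize x := by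
  rw [← Nat.size_le]
  have := List.single_le_sum (l := x.map fun n => Nat.size n + 1) (fun _ _ => Nat.zero_le _) _
    (List.mem_map_of_mem h)
  exact (Nat.le_succ _).trans this

theorem inputSize_append (x y : List ℕ) : inputSize (x ++ y) = inputSize x + inputSize y := by
  simp [inputSize]

/-- Bit lengths add under multiplication, so the product of the denominators is about as short as
the encoding itself; no least common multiple is needed. -/
theorem prod_den_lt (l : List ℚ) : (l.map Rat.den).prod < 2 ^ (inputSize (l.flatMap encodeRat) + 1) := by
  have key : (l.map Rat.den).prod ≤ 2 ^ inputSize (l.flatMap encodeRat) := by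
    induction l with
    | nil => simp [inputSize]
    | cons x l ih =>
      rw [List.map_cons, List.prod_cons, List.flatMap_cons, inputSize_append, pow_add]
      exact Nat.mul_le_mul (lt_two_pow_inputSize (by simp [encodeRat])).le ih
  rw [pow_succ]
  have : 0 < 2 ^ inputSize (l.flatMap encodeRat) := by positivity
  omega

theorem commonDen_lt : I.commonDen < 2 ^ (inputSize I.encode + 1) := by
  refine (prod_den_lt I.rationals).trans_le (Nat.pow_le_pow_right (by norm_num) ?_)
  rw [encode_eq, inputSize_append, inputSize_append]
  omega

theorem bounded_initMemory : Bounded (inputSize I.encode) (initMemory I.encode) := by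
  intro a i
  unfold initMemory
  split_ifs with h
  · cases i with
    | zero => exact (length_le_inputSize _).trans_lt Nat.lt_two_pow_self
    | succ i =>
      rw [List.getD_cons_succ, List.getD_eq_getElem?_getD]
      cases hi : I.encode[i]? with
      | none => simp
      | some v => exact lt_two_pow_inputSize (List.mem_of_getElem? hi)
  · positivity

/-- The instance with all rational numbers scaled by the common denominator. -/
def scaled (K : ℕ) : ScaledInstance := scaledInput K I.input I.rationals.length I.commonDen

variable (K : ℕ)

theorem scaled_n₁ : (I.scaled K).n₁ = I.n₁ := I.input_one
theorem scaled_n₂ : (I.scaled K).n₂ = I.n₂ := I.input_two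
theorem scaled_m₀ : (I.scaled K).m₀ = I.m₀ := I.input_three

theorem scaled_m {s : ℕ} (hs : s < I.n₁) : (I.scaled K).m s = I.actions s := I.input_actions hs

theorem scaled_off {s : ℕ} (hs : s ≤ I.n₁) : (I.scaled K).off s = I.offset s :=
  Finset.sum_congr rfl fun s' hs' => I.scaled_m K (by rw [Finset.mem_range] at hs'; omega)

theorem scaled_E : (I.scaled K).E = I.offset I.n₁ := by
  rw [ScaledInstance.E, scaled_n₁, scaled_off _ _ le_rfl]

theorem scaled_pos : (I.scaled K).pos = I.m₀ * I.n₁ := by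
  rw [ScaledInstance.pos, scaled_n₁, scaled_m₀]

theorem scaled_nom : (I.scaled K).nom = I.m₀ * I.n₁ + I.offset I.n₁ * I.n₂ := by
  rw [ScaledInstance.nom, scaled_pos, scaled_E, scaled_n₂]

theorem scaled_alt : (I.scaled K).alt = I.m₀ * I.n₁ + I.offset I.n₁ * I.n₂ + I.n₂ := by
  rw [ScaledInstance.alt, scaled_nom, scaled_n₂]

/-- The division by the denominator is exact, and `toNat` loses nothing since all the rationals are
nonnegative. -/
theorem scaled_q {j : ℕ} {x : ℚ} (hx : I.rationals[j]? = some x) :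
    ((I.scaled K).q j : ℚ) = x * I.commonDen := by
  have hj : j < I.rationals.length := (List.getElem?_eq_some_iff.1 hx).1
  have hmem : x ∈ I.rationals := List.mem_of_getElem? hx
  have hdvd : x.den ∣ I.commonDen := List.dvd_prod (List.mem_map_of_mem hmem)
  have hq : (I.scaled K).q j = x.num.toNat * (I.commonDen / x.den) := by
    simp [scaled, scaledInput, hj, I.input_num hx, I.input_den hx]
  have hden : (x.den : ℚ) ≠ 0 := by exact_mod_cast x.den_nz
  have hnum : ((x.num.toNat : ℕ) : ℚ) = x.num := by
    have := Int.toNat_of_nonneg (Rat.num_nonneg.2 (I.rationals_nonneg hmem))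
    exact_mod_cast this
  rw [hq, Nat.cast_mul, Nat.cast_div hdvd hden, hnum]
  nth_rewrite 3 [← Rat.num_div_den x]
  field_simp

variable {I K}

theorem mul_lt_two_pow {x y m n : ℕ} (hx : x < 2 ^ m) (hy : y < 2 ^ n) : x * y < 2 ^ (m + n) := by
  rw [pow_add]
  exact Nat.mul_lt_mul'' hx hy

variable (I K)

/-- A bound for the number of bits of the scaled instance. -/
def bits (K N : ℕ) : ℕ := K + 5 * N + 1

/-- A bound for the numbers of iterations of the loops. -/
def iterations (K N : ℕ) : ℕ := N * N * N * (K * N * N + 1) + (K * N * N + 1) + N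

/-- The header is in binary, but the listed probabilities and rewards make each size at most the
length of the list; this uses `n₁, n₂ > 0`. Hence loops over states and actions are polynomial. -/
theorem sizes_le : I.n₁ ≤ inputSize I.encode ∧ I.rationals.length ≤ inputSize I.encode ∧
    I.n₂ ≤ inputSize I.encode ∧ I.m₀ ≤ inputSize I.encode ∧
    I.offset I.n₁ ≤ inputSize I.encode := by
  have h₁ := I.length_encode
  have h₂ := length_le_inputSize I.encode
  have h₃ := I.length_rationals
  have h₄ : I.m₀ ≤ I.m₀ * I.n₁ := Nat.le_mul_of_pos_right _ I.n₁_pos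
  have h₅ : I.offset I.n₁ ≤ I.offset I.n₁ * I.n₂ := Nat.le_mul_of_pos_right _ I.n₂_pos
  omega

theorem scaled_fits : (I.scaled K).Fits (bits K (inputSize I.encode))
    (iterations K (inputSize I.encode)) := by
  obtain ⟨h₁, h₂, h₃, h₄, h₅⟩ := I.sizes_le
  set N := inputSize I.encode with hN
  have hNlt : N < 2 ^ N := Nat.lt_two_pow_self
  have hpow : ∀ {x m : ℕ}, x < 2 ^ m → m ≤ bits K N → x < 2 ^ bits K N := fun h h' =>
    h.trans_le (Nat.pow_le_pow_right (by norm_num) h')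
  have hT : (I.scaled K).T = K * I.n₁ * I.n₁ + 1 := by
    rw [ScaledInstance.T, scaled_n₁]
    rfl
  have htot : (I.scaled K).total = I.m₀ * I.n₂ * I.offset I.n₁ * (I.scaled K).T := by
    rw [ScaledInstance.total, scaled_m₀, scaled_n₂, scaled_E]
  have hKN : K * I.n₁ < 2 ^ (K + N) := mul_lt_two_pow Nat.lt_two_pow_self (by omega)
  have hTlt : (I.scaled K).T < 2 ^ (K + N + N + 1) := by
    have := mul_lt_two_pow hKN (h₁.trans_lt hNlt)
    rw [hT, pow_succ]
    omega
  -- The number of candidates has the largest bound, `3 N + (K + 2 N + 1)` bits, which determines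
  -- `bits`.
  have htotlt := mul_lt_two_pow (mul_lt_two_pow (mul_lt_two_pow (h₄.trans_lt hNlt)
    (h₃.trans_lt hNlt)) (h₅.trans_lt hNlt)) hTlt
  have hTle : (I.scaled K).T ≤ K * N * N + 1 := by
    rw [hT]
    gcongr
  constructor
  · intro j
    by_cases hj : j < I.rationals.length
    · have hx := List.getElem?_eq_getElem hj
      have hq : (I.scaled K).q j = I.rationals[j].num.toNat * (I.commonDen / I.rationals[j].den) := by
        simp [scaled, scaledInput, hj, I.input_num hx, I.input_den hx]
      rw [hq, ← I.input_num hx]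
      refine hpow (mul_lt_two_pow (I.bounded_initMemory 0 _)
        ((Nat.div_le_self _ _).trans_lt I.commonDen_lt)) ?_
      unfold bits
      omega
    · have : (I.scaled K).q j = 0 := by simp [scaled, scaledInput, hj]
      rw [this]
      positivity
  · rw [scaled_n₁]
    exact hpow (h₁.trans_lt hNlt) (by unfold bits; omega)
  · rw [scaled_n₂]
    exact hpow (h₃.trans_lt hNlt) (by unfold bits; omega)
  · rw [scaled_E]
    exact hpow (h₅.trans_lt hNlt) (by unfold bits; omega)
  · rw [scaled_n₁]
    exact hpow hKN (by unfold bits; omega)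
  · exact hpow hTlt (by unfold bits; omega)
  · rw [htot]
    exact hpow htotlt (by unfold bits; omega)
  · rw [scaled_n₁]
    unfold iterations
    omega
  · rw [scaled_n₂]
    unfold iterations
    omega
  · rw [scaled_E]
    unfold iterations
    omega
  · unfold iterations
    omega
  · rw [htot]
    calc I.m₀ * I.n₂ * I.offset I.n₁ * (I.scaled K).T ≤ N * N * N * (K * N * N + 1) := by gcongr
      _ ≤ _ := by unfold iterations; omega

/-- With `b` bits for the data, a rest has `4 b` bits and a sum of fewer than `2 ^ b` rests has `5
b`; two more bits allow for adding the bonus to such a sum. -/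
theorem scheme_solves : WP (5 * bits K (inputSize I.encode) + 2) (iterations K (inputSize I.encode))
    (scheme K) (Solved (I.scaled K)) (initMemory I.encode) := by
  obtain ⟨h₁, h₂, h₃, h₄, h₅⟩ := I.sizes_le
  have hfits := I.scaled_fits K
  have hinit := I.bounded_initMemory
  set N := inputSize I.encode with hN
  have hNlt : N < 2 ^ N := Nat.lt_two_pow_self
  have hpow : ∀ {x m : ℕ}, x < 2 ^ m → m ≤ 5 * bits K N + 2 → x < 2 ^ (5 * bits K N + 2) :=
    fun h h' => h.trans_le (Nat.pow_le_pow_right (by norm_num) h')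
  have halt : (I.scaled K).alt ≤ N := by
    rw [scaled_alt]
    have := I.length_rationals
    omega
  have hm : ∀ s < (I.scaled K).n₁, 0 < (I.scaled K).m s := by
    intro s hs
    rw [scaled_n₁] at hs
    rw [scaled_m _ _ hs, actions, dif_pos hs]
    exact I.m_pos _
  unfold scheme
  refine WP.set_seq (hinit.mono (by unfold bits; omega))
    (hpow (Nat.lt_two_pow_self (n := K)) (by unfold bits; omega)) fun hσ => ?_
  simp only [Expr.eval_lit] at hσ ⊢
  generalize hσE : write _ _ _ _ = σ at hσ ⊢
  have fr : ∀ a, a ≠ 0 → a ≠ rK → ∀ i, σ a i = 0 := fun a g₁ g₂ i => by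
    subst hσE
    simp [write, initMemory, g₁, g₂]
  refine WP.seq (WP.prepare (b := bits K N) (inp := I.input) (J := I.rationals.length)
    (D := I.commonDen) (by omega) rfl hfits hσ ?_ ?_ ?_ ?_ ?_ ?_ ?_ (fr _ (by decide) (by decide))
    (fr _ (by decide) (by decide) 0) (fun i => fr _ (by decide) (by decide) _) ?_ ?_)
    fun τ hτ hf ⟨hr, hout, hzero⟩ => ?_
  · subst hσE
    funext i
    simp [write, input]
  · rw [input_zero, input_one]
    omega
  · unfold iterations
    omega
  · exact I.prod_input_den
  · intro j hj
    rw [I.input_den (List.getElem?_eq_getElem hj)]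
    exact Rat.den_pos _
  · exact hpow I.commonDen_lt (by unfold bits; omega)
  · subst hσE
    simp [write]
  · rw [input_one]
    refine hpow (m := N + 3) ?_ (by unfold bits; omega)
    have : 0 < 2 ^ N := by positivity
    rw [pow_add]
    omega
  · exact hpow (halt.trans_lt hNlt) (by unfold bits; omega)
  · refine WP.candidates (b := bits K N) le_rfl hfits hτ hr hm ?_ ?_ hout hzero ?_
    · rw [scaled_m₀]
      exact I.m₀_pos
    · rw [scaled_n₁]
      exact I.n₁_pos
    · rw [hf _ (by decide), fr _ (by decide) (by decide)]

/-! ### Transfer of the guarantee from scores to worst-case rewards -/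

variable {I K}

/-- The actions of a policy, indexed by natural numbers. -/
def Policy.actNat (π : I.Policy) (s : ℕ) : ℕ := if h : s < I.n₁ then π.act ⟨s, h⟩ else 0

theorem Policy.actNat_val (π : I.Policy) (s : Fin I.n₁) : π.actNat s = π.act s := by simp [actNat]

theorem Policy.isPolicy_actNat (π : I.Policy) : (I.scaled K).IsPolicy π.actNat := by
  intro s hs
  rw [scaled_n₁] at hs
  rw [scaled_m _ _ hs, actions, actNat, dif_pos hs, dif_pos hs]
  exact (π.act ⟨s, hs⟩).2

theorem q_p₀ (a : Fin I.m₀) (s : Fin I.n₁) :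
    ((I.scaled K).q (a * (I.scaled K).n₁ + s) : ℚ) = I.p₀ a s * I.commonDen := by
  rw [scaled_n₁]
  exact I.scaled_q K (I.rationals_p₀ a s)

theorem q_p₁ (s : Fin I.n₁) (a : Fin (I.m s)) (t : Fin I.n₂) :
    ((I.scaled K).q ((I.scaled K).pos + (((I.scaled K).off s + a) * (I.scaled K).n₂ + t)) : ℚ) =
      I.p₁ s a t * I.commonDen := by
  rw [scaled_pos, scaled_off _ _ s.2.le, scaled_n₂]
  exact I.scaled_q K (I.rationals_p₁ s a t)

theorem q_r (t : Fin I.n₂) :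
    ((I.scaled K).q ((I.scaled K).nom + t) : ℚ) = I.r t * I.commonDen := by
  rw [scaled_nom]
  exact I.scaled_q K (I.rationals_r t)

theorem q_r' (t : Fin I.n₂) :
    ((I.scaled K).q ((I.scaled K).alt + t) : ℚ) = I.r' t * I.commonDen := by
  rw [scaled_alt]
  exact I.scaled_q K (I.rationals_r' t)

/-- Each of the three factors carries one common denominator. The rest is scaled by the same cube,
so that the minimum in the score makes sense. -/
theorem cast_gain (π : I.Policy) (s : Fin I.n₁) (t : Fin I.n₂) :
    ((I.scaled K).gain π.init t s (π.act s) : ℚ) =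
      I.p₀ π.init s * I.p₁ s (π.act s) t * (I.r t - I.r' t) * (I.commonDen : ℚ) ^ 3 := by
  have hle : (I.scaled K).q ((I.scaled K).alt + t) ≤ (I.scaled K).q ((I.scaled K).nom + t) := by
    have : ((I.scaled K).q ((I.scaled K).alt + t) : ℚ) ≤ (I.scaled K).q ((I.scaled K).nom + t) := by
      rw [q_r, q_r']
      exact mul_le_mul_of_nonneg_right (I.r'_le_r t) (Nat.cast_nonneg _)
    exact_mod_cast this
  rw [ScaledInstance.gain, Nat.cast_mul, Nat.cast_mul, Nat.cast_sub hle, q_p₀, q_p₁, q_r, q_r']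
  ring

theorem cast_mean (π : I.Policy) (s : Fin I.n₁) :
    ((I.scaled K).mean s (π.act s) : ℚ) =
      (∑ t, I.p₁ s (π.act s) t * I.r t) * (I.commonDen : ℚ) ^ 2 := by
  rw [ScaledInstance.mean, Nat.cast_sum, Finset.sum_mul]
  have h := I.scaled_n₂ K
  rw [show Finset.range (I.scaled K).n₂ = Finset.range I.n₂ by rw [h], ← Fin.sum_univ_eq_sum_range
    (fun u => (((I.scaled K).q ((I.scaled K).pos +
      (((I.scaled K).off s + π.act s) * (I.scaled K).n₂ + u)) *
        (I.scaled K).q ((I.scaled K).nom + u) : ℕ) : ℚ))]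
  refine Finset.sum_congr rfl fun t _ => ?_
  rw [Nat.cast_mul, q_p₁, q_r]
  ring

theorem cast_rest (π : I.Policy) (s : Fin I.n₁) (t : Fin I.n₂) :
    ((I.scaled K).rest π.init t s (π.act s) : ℚ) =
      (I.p₀ π.init s * ∑ t, I.p₁ s (π.act s) t * I.r t) * (I.commonDen : ℚ) ^ 3 -
        I.p₀ π.init s * I.p₁ s (π.act s) t * (I.r t - I.r' t) * (I.commonDen : ℚ) ^ 3 := by
  -- The subtraction in `rest` is not truncated: the gain is at most the contribution of `t` to the
  -- mean, as `r t - r' t ≤ r t`.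
  have hle : (I.scaled K).gain π.init t s (π.act s) ≤
      (I.scaled K).q (π.init * (I.scaled K).n₁ + s) * (I.scaled K).mean s (π.act s) := by
    rw [ScaledInstance.gain, mul_assoc]
    refine Nat.mul_le_mul_left _ ((Nat.mul_le_mul_left _ (Nat.sub_le _ _)).trans ?_)
    exact Finset.single_le_sum (f := fun u => (I.scaled K).q ((I.scaled K).pos +
      (((I.scaled K).off s + π.act s) * (I.scaled K).n₂ + u)) *
        (I.scaled K).q ((I.scaled K).nom + u)) (fun _ _ => Nat.zero_le _)
      (Finset.mem_range.2 (by rw [scaled_n₂]; exact t.2))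
  rw [ScaledInstance.rest, Nat.cast_sub hle, Nat.cast_mul, cast_gain, cast_mean, q_p₀]
  ring

theorem reward_eq (π : I.Policy) :
    reward π = ∑ s, I.p₀ π.init s * ∑ t, I.p₁ s (π.act s) t * I.r t := by
  simp only [reward, expectedReward, terminalProb, Finset.sum_mul, Finset.mul_sum]
  rw [Finset.sum_comm]
  exact Finset.sum_congr rfl fun s _ => Finset.sum_congr rfl fun t _ => mul_assoc _ _ _

theorem cast_sum_range (f : ℕ → ℕ → ℕ) (π : I.Policy) :
    ((∑ s ∈ Finset.range (I.scaled K).n₁, f s (π.actNat s) : ℕ) : ℚ) =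
      ∑ s : Fin I.n₁, (f s (π.act s) : ℚ) := by
  rw [scaled_n₁, ← Fin.sum_univ_eq_sum_range (fun s => f s (π.actNat s)), Nat.cast_sum]
  simp only [Policy.actNat_val]

theorem cast_score (π : I.Policy) (t : Fin I.n₂) :
    ((I.scaled K).score π.init t π.actNat : ℚ) =
      min (lossAt π t) (reward π - lossAt π t) * (I.commonDen : ℚ) ^ 3 := by
  have hloss : lossAt π t = (∑ s, I.p₀ π.init s * I.p₁ s (π.act s) t) * (I.r t - I.r' t) := rfl
  rw [ScaledInstance.score, Nat.cast_min, cast_sum_range, cast_sum_range,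
    min_mul_of_nonneg _ _ (by positivity : (0 : ℚ) ≤ (I.commonDen : ℚ) ^ 3)]
  simp only [cast_gain, cast_rest]
  rw [Finset.sum_sub_distrib, ← Finset.sum_mul, ← Finset.sum_mul, ← Finset.sum_mul, ← hloss, ← reward_eq, sub_mul]

/-- The policy with given numbers of actions. -/
def Policy.ofNat (a₀ : ℕ) (π : ℕ → ℕ) (ha₀ : a₀ < I.m₀) (hπ : ∀ s : Fin I.n₁, π s < I.m s) : I.Policy :=
  ⟨⟨a₀, ha₀⟩, fun s => ⟨π s, hπ s⟩⟩

theorem exists_policy_of_solved {τ : Memory} (h : Solved (I.scaled K) τ) :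
    ∃ π₁ : I.Policy, HasOutput τ π₁.encode ∧ ∀ π : I.Policy,
      ((K - 1 : ℕ) : ℚ) * min (worstReward π) (loss π) ≤ K * worstReward π₁ := by
  obtain ⟨h₀, a₀, π, best, ha₀, hπ, h₁, h₂, hbest, hopt⟩ := h
  rw [scaled_m₀] at ha₀ hopt
  rw [scaled_n₁] at h₀ h₂
  rw [scaled_n₂] at hbest hopt
  have hπ' : ∀ s : Fin I.n₁, π s < I.m s := fun s => by
    have := hπ s (by rw [scaled_n₁]; exact s.2)
    rwa [scaled_m _ _ s.2, actions_val] at this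
  set π₁ : I.Policy := .ofNat a₀ π ha₀ hπ' with hπ₁
  have hD : (0 : ℚ) < (I.commonDen : ℚ) ^ 3 := by
    have : (0 : ℚ) < I.commonDen := by exact_mod_cast I.commonDen_pos
    positivity
  refine ⟨π₁, ⟨?_, ?_⟩, fun ρ => ?_⟩
  · simp [Policy.encode, h₀]
  · rintro ⟨i, hi⟩
    cases i with
    | zero => simpa [Policy.encode, hπ₁, Policy.ofNat] using h₁
    | succ s =>
      have hs : s < I.n₁ := by simpa [Policy.encode] using hi
      simpa [Policy.encode, hπ₁, Policy.ofNat] using h₂ s hs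
  · have hworst : (best : ℚ) ≤ worstReward π₁ * (I.commonDen : ℚ) ^ 3 := by
      -- If no candidate improved on `0`, nonnegativity of the worst-case reward suffices.
      rcases hbest with rfl | ⟨t, ht, rfl⟩
      · rw [Nat.cast_zero]
        exact mul_nonneg (worstReward_nonneg π₁ ⟨0, I.n₂_pos⟩) hD.le
      · have hsc := (I.scaled K).score_congr π₁.init t (π := π) (π' := π₁.actNat) fun s hs => by
          rw [scaled_n₁] at hs
          simp [Policy.actNat, hs, hπ₁, Policy.ofNat]
        change ((I.scaled K).score π₁.init t π : ℚ) ≤ _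
        rw [hsc, cast_score π₁ ⟨t, ht⟩]
        exact mul_le_mul_of_nonneg_right (min_lossAt_le_worstReward π₁ ⟨t, ht⟩) hD.le
    obtain ⟨t, ht⟩ := exists_min_le_min_lossAt ρ ⟨0, I.n₂_pos⟩
    have hρ := hopt ρ.init ρ.init.2 t t.2 ρ.actNat ρ.isPolicy_actNat
    have hρ' : ((K - 1 : ℕ) : ℚ) * (I.scaled K).score ρ.init t ρ.actNat ≤ K * best := by
      exact_mod_cast hρ
    rw [cast_score] at hρ'
    refine le_of_mul_le_mul_right ?_ hD
    calc ((K - 1 : ℕ) : ℚ) * min (worstReward ρ) (loss ρ) * (I.commonDen : ℚ) ^ 3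
        ≤ ((K - 1 : ℕ) : ℚ) * min (lossAt ρ t) (reward ρ - lossAt ρ t) * (I.commonDen : ℚ) ^ 3 :=
          mul_le_mul_of_nonneg_right (mul_le_mul_of_nonneg_left ht (Nat.cast_nonneg _)) hD.le
      _ ≤ K * best := (mul_assoc _ _ _).le.trans hρ'
      _ ≤ K * (worstReward π₁ * (I.commonDen : ℚ) ^ 3) :=
          mul_le_mul_of_nonneg_left hworst (Nat.cast_nonneg _)
      _ = _ := (mul_assoc _ _ _).symm

end TwoStageRewardDLP

theorem mainTheorem6 (ε : ℝ) (hε : 0 < ε) :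
    ∃ (P : RAM.Prog) (bound : Polynomial ℕ), ∀ I : TwoStageRewardDLP,
      ∃ π₁ : I.Policy,
        P.OutputsWithin I.encode π₁.encode (bound.eval (RAM.inputSize I.encode)) ∧
        ∀ π : I.Policy,
          1 / (1 + ε) * min ((TwoStageRewardDLP.worstReward π : ℚ) : ℝ)
              ((TwoStageRewardDLP.loss π : ℚ) : ℝ) ≤
            ((TwoStageRewardDLP.worstReward π₁ : ℚ) : ℝ) := by
  -- With `K = k + 1` the guarantee is `k / (k + 1)`, which is at least `1 / (1 + ε)` when `k * ε ≥
  -- 1`.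
  obtain ⟨k, hk⟩ := exists_nat_ge (1 / ε)
  have hkε : 1 ≤ k * ε := (div_le_iff₀ hε).1 hk
  have hkpos : (0 : ℝ) < k := (by positivity : (0 : ℝ) < 1 / ε).trans_le hk
  obtain ⟨p, hp⟩ := (RAM.scheme (k + 1)).exists_polynomial_costWeight
  let X : Polynomial ℕ := Polynomial.X
  let κ : Polynomial ℕ := Polynomial.C (k + 1)
  refine ⟨RAM.scheme (k + 1),
    -- The cost weight at `iterations` many rounds, times `B + 1` for `B = 5 * bits + 2`; `K` is a
    -- constant here.
    p.comp (X * X * X * (κ * X * X + 1) + (κ * X * X + 1) + X) * (5 * (κ + 5 * X + 1) + 2 + 1),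
    fun I => ?_⟩
  obtain ⟨c, τ, hx, hc, -, hsol⟩ := I.scheme_solves (k + 1)
  obtain ⟨π₁, hout, hopt⟩ := TwoStageRewardDLP.exists_policy_of_solved hsol
  refine ⟨π₁, ⟨c, τ, hx, hout, ?_⟩, fun π => ?_⟩
  · rw [hp] at hc
    simpa [X, κ, TwoStageRewardDLP.bits, TwoStageRewardDLP.iterations] using hc
  · have h := hopt π
    rw [Nat.add_sub_cancel] at h
    have h' : (k : ℝ) * min ((TwoStageRewardDLP.worstReward π : ℚ) : ℝ)
        ((TwoStageRewardDLP.loss π : ℚ) : ℝ) ≤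
        (k + 1) * ((TwoStageRewardDLP.worstReward π₁ : ℚ) : ℝ) := by
      exact_mod_cast h
    have hw : (0 : ℝ) ≤ ((TwoStageRewardDLP.worstReward π₁ : ℚ) : ℝ) := by
      exact_mod_cast TwoStageRewardDLP.worstReward_nonneg π₁ ⟨0, I.n₂_pos⟩
    rw [one_div, inv_mul_le_iff₀ (by positivity)]
    -- After multiplication by `k` it remains that `k + 1 ≤ k * (1 + ε)`.
    refine le_of_mul_le_mul_left (h'.trans ?_) hkpos
    nlinarith
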